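/- **Setting.** Let $(\mathcal S,\mathcal A,r,\mathsf P,\gamma)$ be a Markov decision process with finite nonempty state space $\mathcal S$, finite action space $\mathcal A$ and discount factor $\gamma\in(0,1)$. Let $\pi$ be a target policy and $\mu$ a behavior policy, and let $\phi:\mathcal S\to\mathbb R^d$ be feature vectors such that the matrix $\Phi$ with rows $\phi(s)^\top$ has linearly independent columns. Put $\rho(s,a)=\pi(a|s)/\mu(a|s)$ (with $0/0=0$), $\rho_{\max}=\max_{s,a}\rho(s,a)$, $r_{\max}=\max_{s,a}|r(s,a)|$, $B_\phi=\max_s\|\phi(s)\|_2$, $P_\pi(s'|s)=\sum_a\pi(a|s)\mathsf P(s'|s,a)$ (and $P_\mu$ likewise), $r_\pi(s)=\sum_a\pi(a|s)r(s,a)$. Assume * (coverage) $\mu(a|s)>0$ whenever $\pi(a|s)>0$; * (ergodicity) the Markov chain on $\mathcal S$ with transition matrix $P_\mu$ is irreducible and aperiodic. Let $(s_t,a_t)_{t\ge0}$ be the state-action process generated by $\mu$, from an arbitrary initial distribution. **Fixed point.** The chain has a unique stationary distribution $d_\mu$. For the follow-on trace $F_0=1$, $F_{t}=\gamma\rho(s_{t-1},a_{t-1})F_{t-1}+1$,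 the limits $f(i)=d_\mu(i)\lim_{t\to\infty}\mathbb E[F_t\mid s_t=i]$ exist and do not depend on the initial distribution. With $F=\mathrm{diag}(f)$, the matrix $K=\Phi^\top F(I-\gamma P_\pi)\Phi$ is invertible; let $\theta^*=K^{-1}\Phi^\top F r_\pi$ be the ETD fixed point. Let $\mu_0=\min_{\|x\|_2=1}x^\top Kx$, which is positive (if $d\ge1$), and $L_0=\|K\|_2$. There are constants $C_M\ge0$ and $\chi\in(0,1)$, $\chi\ne\gamma$, with $$\textstyle\sum_s|P_\mu^t(s|s_0)-d_\mu(s)|\le C_M\chi^t\qquad\text{for all } s_0\in\mathcal S,\ t\ge0.\tag{1}$$ **Algorithm.** PER-ETD(0) with period length $b$ starts from $\theta_0=0$. At iteration $t$ it restarts the trace: $F_t^0=1$, $F_t^{\tau+1}=\gamma\rho_t^\tau F_t^\tau+1$ for $0\le\tau<b$, where the indices $t,\tau$ refer to time $t(b+1)+\tau$. It then sets $$\theta_{t+1}=\Pi_\Theta\Big(\theta_t+\eta_tF_t^b\rho_t^b\big(r_t^b+\gamma\theta_t^\top\phi_t^{b+1}-\theta_t^\top\phi_t^b\big)\phi_t^b\Big).$$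 Computing $\theta_T$ uses $T(b+1)$ samples. Here $\eta_t=\frac{2}{\mu_0(t+t_0)}$ with $t_0=\frac{8L_0^2}{\mu_0^2}$, and $\Pi_\Theta$ is the projection onto $\Theta=\{\theta:\|\theta\|_2\le B_\theta\}$ with $B_\theta=\frac{\|\Phi^\top\|_2\,r_{\max}}{(1-\gamma)\mu_0}$; one has $\theta^*\in\Theta$. **Claim.** Let $C_M\ge 0$ and $\chi\in(0,1)$, $\chi\neq\gamma$, be any constants satisfying (1). Put $\xi=\max\{\gamma,\chi\}$, $C_b=B_\phi(1+\gamma)\big(\frac{C_M}{|\chi-\gamma|}+1+\|f\|_1\big)$ and $b_0=\max\big\{0,\big\lceil\frac{\log\mu_0-\log(5C_bB_\phi)}{\log\xi}\big\rceil\big\}$. (a) If $\gamma^2\rho_{\max}\le1$ and $b=b(T)=\max\big\{b_0,\big\lceil\frac{\log T}{\log(1/\xi)}\big\rceil\big\}$, then $\mathbb E\|\theta_T-\theta^*\|_2^2=\tilde{\mathcal O}(1/T)$, i.e. it is at most $C(\log T)^k/T$ for all $T\ge2$, for some constants $C$ and $k$. Moreover, for every $\epsilon\in(0,\frac12]$ some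 $T$ gives $\mathbb E\|\theta_T-\theta^*\|_2^2\le\epsilon$ with $T(b(T)+1)=\tilde{\mathcal O}(1/\epsilon)$ samples. (b) If $\gamma^2\rho_{\max}>1$ and $b=b(T)=\max\big\{b_0,\big\lceil\frac{\log T}{\log(\gamma^2\rho_{\max})+\log(1/\xi)}\big\rceil\big\}$, then $\mathbb E\|\theta_T-\theta^*\|_2^2=\mathcal O(1/T^a)$ for $T\ge 1$, where $a=\frac{1}{\log_{1/\xi}(\gamma^2\rho_{\max})+1}\in(0,1)$. Moreover, for every $\epsilon\in(0,\frac12]$ some $T$ gives $\mathbb E\|\theta_T-\theta^*\|_2^2\le\epsilon$ with $T(b(T)+1)=\tilde{\mathcal O}(\epsilon^{-1/a})$ samples. The constants hidden in $\mathcal O,\tilde{\mathcal O}$ depend neither on $T$ and $\epsilon$ nor on the initial distribution; $\tilde{\mathcal O}$ hides powers of $\log T$, respectively $\log(1/\epsilon)$. -/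

import Mathlib

open MeasureTheory ProbabilityTheory Filter Topology Matrix

universe u v w

namespace PerETD

noncomputable section

open scoped Matrix.Norms.L2Operator

/-- A discounted Markov decision process with state space `S` and action space `A`. -/
structure MDP (S A : Type*) [Fintype S] where
  /-- reward `r(s, a)` -/
  r : S → A → ℝ
  /-- transition probability `P(s' | s, a)`, written `P s a s'` -/
  P : S → A → S → ℝ
  P_nonneg : ∀ s a s', 0 ≤ P s a s'
  P_sum : ∀ s a, ∑ s', P s a s' = 1
  /-- discount factor -/
  γ : ℝ
  γ_pos : 0 < γ
  γ_lt_one : γ < 1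

/-- A stationary randomized policy; `prob s a` is the probability of the action `a` in state `s`. -/
structure Policy (S A : Type*) [Fintype A] where
  prob : S → A → ℝ
  nonneg : ∀ s a, 0 ≤ prob s a
  sum_eq_one : ∀ s, ∑ a, prob s a = 1

/-! ### Finite Markov chains -/

section MarkovChain

variable {S : Type*} [Fintype S] [DecidableEq S]

/-- Every state has period one: `1` is the only common divisor of the possible return times. -/
def IsAperiodic (P : Matrix S S ℝ) : Prop :=
  ∀ s : S, ∀ k : ℕ, (∀ n : ℕ, 0 < n → 0 < (P ^ n) s s → k ∣ n) → k = 1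

/-- `d` is a stationary probability distribution of the chain with transition matrix `P`. -/
structure IsStationaryDist (P : Matrix S S ℝ) (d : S → ℝ) : Prop where
  nonneg : ∀ s, 0 ≤ d s
  sum_eq_one : ∑ s, d s = 1
  stationary : d ᵥ* P = d

/-- `‖d_t - d‖₁ ≤ C χ ^ t` for the law `d_t` after `t` steps, from every initial state. -/
structure IsGeometricRate (P : Matrix S S ℝ) (d : S → ℝ) (C χ : ℝ) : Prop where
  C_nonneg : 0 ≤ C
  χ_pos : 0 < χ
  χ_lt_one : χ < 1
  bound : ∀ (s₀ : S) (t : ℕ), ∑ s, |(P ^ t) s₀ s - d s| ≤ C * χ ^ t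

end MarkovChain

variable {S : Type u} {A : Type v} [Fintype S] [Fintype A] [DecidableEq S]

/-- Transition matrix of the state chain under the policy `π`. -/
def transMatrix (M : MDP S A) (π : Policy S A) : Matrix S S ℝ :=
  Matrix.of fun s s' => ∑ a, π.prob s a * M.P s a s'

/-- Expected one-step reward under the policy `π`. -/
def meanReward (M : MDP S A) (π : Policy S A) (s : S) : ℝ := ∑ a, M.r s a * π.prob s a

/-- Importance sampling ratio `π(a|s) / μ(a|s)`. -/
def ratio (π μ : Policy S A) (s : S) (a : A) : ℝ := π.prob s a / μ.prob s a

/-- Largest importance sampling ratio. -/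
def rhoMax (π μ : Policy S A) : ℝ := ⨆ p : S × A, ratio π μ p.1 p.2

/-- Coverage: the behavior policy `μ` takes every action that the target policy `π` takes. -/
def Coverage (π μ : Policy S A) : Prop := ∀ s a, 0 < π.prob s a → 0 < μ.prob s a

/-- A state-action trajectory of the process generated by the policy `μ`, on any probability
space and with any initial distribution, characterized by its finite-dimensional laws. -/
structure Trajectory (M : MDP S A) (μ : Policy S A) where
  /-- sample space -/
  Ω : Type w
  [instΩ : MeasurableSpace Ω]
  /-- probability measure -/
  Pr : Measure Ω
  [instPr : IsProbabilityMeasure Pr]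
  /-- state at time `t` -/
  s : ℕ → Ω → S
  /-- action at time `t` -/
  a : ℕ → Ω → A
  measurableSet_fiber : ∀ t x u, MeasurableSet {ω | s t ω = x ∧ a t ω = u}
  law : ∀ (n : ℕ) (x : ℕ → S) (u : ℕ → A),
    Pr.real {ω | ∀ k ≤ n, s k ω = x k ∧ a k ω = u k} =
      Pr.real {ω | s 0 ω = x 0} *
        (∏ k ∈ Finset.range n, μ.prob (x k) (u k) * M.P (x k) (u k) (x (k + 1))) *
        μ.prob (x n) (u n)

attribute [instance] Trajectory.instΩ Trajectory.instPr

/-- Follow-on trace `F₀ = 1`, `F_{n+1} = γ ρ_n F_n + 1`. -/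
def followOn (γ : ℝ) (ρ : ℕ → ℝ) : ℕ → ℝ
  | 0 => 1
  | n + 1 => γ * ρ n * followOn γ ρ n + 1

/-- `E[F_t | s_t = i]` for the follow-on trace started at time `0` and never restarted. -/
def Trajectory.condTrace {M : MDP S A} {μ : Policy S A} (X : Trajectory.{u, v, w} M μ) (π : Policy S A)
    (t : ℕ) (i : S) : ℝ :=
  ∫ ω, followOn M.γ (fun k => ratio π μ (X.s k ω) (X.a k ω)) t
    ∂(ProbabilityTheory.cond X.Pr {ω | X.s t ω = i})

/-! ### The fixed point of ETD(0) -/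

variable {d : ℕ}

/-- Feature matrix, with the feature vectors as rows. -/
def featureMatrix (φ : S → EuclideanSpace ℝ (Fin d)) : Matrix S (Fin d) ℝ :=
  Matrix.of fun s j => φ s j

/-- `Φᵀ F (I - γ P_π) Φ` with `F = diag f`. -/
def keyMatrix (M : MDP S A) (π : Policy S A) (φ : S → EuclideanSpace ℝ (Fin d)) (f : S → ℝ) :
    Matrix (Fin d) (Fin d) ℝ :=
  (featureMatrix φ)ᵀ * Matrix.diagonal f * (1 - M.γ • transMatrix M π) * featureMatrix φ

/-- `θ* = (Φᵀ F (I - γ P_π) Φ)⁻¹ Φᵀ F r_π`. -/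
def thetaStar (M : MDP S A) (π : Policy S A) (φ : S → EuclideanSpace ℝ (Fin d)) (f : S → ℝ) :
    EuclideanSpace ℝ (Fin d) :=
  WithLp.toLp 2 ((keyMatrix M π φ f)⁻¹ *ᵥ
    (((featureMatrix φ)ᵀ * Matrix.diagonal f) *ᵥ meanReward M π))

/-! ### Constants -/

/-- Strong monotonicity constant: the minimum of `xᵀ K x` over unit vectors `x`, where
`K` is the key matrix, i.e. the least eigenvalue of its symmetric part. -/
def mu0 (M : MDP S A) (π : Policy S A) (φ : S → EuclideanSpace ℝ (Fin d)) (f : S → ℝ) : ℝ :=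
  sInf {c : ℝ | ∃ x : EuclideanSpace ℝ (Fin d),
    ‖x‖ = 1 ∧ c = x.ofLp ⬝ᵥ (keyMatrix M π φ f *ᵥ x.ofLp)}

/-- Lipschitz constant: the spectral norm of the key matrix. -/
def L0 (M : MDP S A) (π : Policy S A) (φ : S → EuclideanSpace ℝ (Fin d)) (f : S → ℝ) : ℝ :=
  ‖keyMatrix M π φ f‖

/-- Largest absolute reward. -/
def rMax (M : MDP S A) : ℝ := ⨆ p : S × A, |M.r p.1 p.2|

/-- Largest Euclidean norm of a feature vector. -/
def Bphi (φ : S → EuclideanSpace ℝ (Fin d)) : ℝ := ⨆ s, ‖φ s‖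

/-- Radius `‖Φᵀ‖₂ r_max / ((1 - γ) μ₀)` of the projection ball. -/
def Btheta (M : MDP S A) (π : Policy S A) (φ : S → EuclideanSpace ℝ (Fin d)) (f : S → ℝ) : ℝ :=
  ‖(featureMatrix φ)ᵀ‖ * rMax M / ((1 - M.γ) * mu0 M π φ f)

/-- `t₀ = 8 L₀² / μ₀²`. -/
def t0 (M : MDP S A) (π : Policy S A) (φ : S → EuclideanSpace ℝ (Fin d)) (f : S → ℝ) : ℝ :=
  8 * L0 M π φ f ^ 2 / mu0 M π φ f ^ 2

/-- `η_t = 2 / (μ₀ (t + t₀))`. -/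
def stepsize (M : MDP S A) (π : Policy S A) (φ : S → EuclideanSpace ℝ (Fin d)) (f : S → ℝ)
    (t : ℕ) : ℝ :=
  2 / (mu0 M π φ f * (t + t0 M π φ f))

/-- `ξ = max {γ, χ}`. -/
def xi (M : MDP S A) (χ : ℝ) : ℝ := max M.γ χ

/-- `C_b = B_φ (1 + γ) (C_M / |χ - γ| + 1 + ‖f‖₁)`. -/
def Cb (M : MDP S A) (φ : S → EuclideanSpace ℝ (Fin d)) (f : S → ℝ) (CM χ : ℝ) : ℝ :=
  Bphi φ * (1 + M.γ) * (CM / |χ - M.γ| + (1 + ∑ s, |f s|))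

/-- The part `⌈(log μ₀ - log (5 C_b B_φ)) / log ξ⌉` of the period length that does not depend on
the number of iterations. -/
def basePeriod (M : MDP S A) (π : Policy S A) (φ : S → EuclideanSpace ℝ (Fin d)) (f : S → ℝ)
    (CM χ : ℝ) : ℕ :=
  ⌈(Real.log (mu0 M π φ f) - Real.log (5 * Cb M φ f CM χ * Bphi φ)) / Real.log (xi M χ)⌉₊

/-- Period length for `T` iterations when `γ² ρ_max ≤ 1`. -/
def periodLow (M : MDP S A) (π : Policy S A) (φ : S → EuclideanSpace ℝ (Fin d)) (f : S → ℝ)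
    (CM χ : ℝ) (T : ℕ) : ℕ :=
  max (basePeriod M π φ f CM χ) ⌈Real.log T / Real.log (1 / xi M χ)⌉₊

/-- Period length for `T` iterations when `γ² ρ_max > 1`. -/
def periodHigh (M : MDP S A) (π μ : Policy S A) (φ : S → EuclideanSpace ℝ (Fin d)) (f : S → ℝ)
    (CM χ : ℝ) (T : ℕ) : ℕ :=
  max (basePeriod M π φ f CM χ)
    ⌈Real.log T / (Real.log (M.γ ^ 2 * rhoMax π μ) + Real.log (1 / xi M χ))⌉₊

/-- `a = 1 / (log_{1/ξ} (γ² ρ_max) + 1)`. -/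
def rateExp (M : MDP S A) (π μ : Policy S A) (χ : ℝ) : ℝ :=
  1 / (Real.logb (1 / xi M χ) (M.γ ^ 2 * rhoMax π μ) + 1)

/-! ### The algorithm -/

/-- Euclidean projection onto the closed ball of radius `B` around the origin. -/
def projBall (B : ℝ) (x : EuclideanSpace ℝ (Fin d)) : EuclideanSpace ℝ (Fin d) :=
  if ‖x‖ ≤ B then x else (B / ‖x‖) • x

/-- Iterates `θ_t` of PER-ETD(0) along the state-action sequence `(s, a)`, with projection radius
`B`, stepsizes `η` and period length `b`. Iteration `t` uses the times `t(b+1), …, t(b+1)+b+1`. -/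
def iterate (M : MDP S A) (π μ : Policy S A) (φ : S → EuclideanSpace ℝ (Fin d)) (B : ℝ)
    (η : ℕ → ℝ) (b : ℕ) (s : ℕ → S) (a : ℕ → A) : ℕ → EuclideanSpace ℝ (Fin d)
  | 0 => 0
  | t + 1 =>
    let θ := iterate M π μ φ B η b s a t
    let n := t * (b + 1)
    let F := followOn M.γ (fun τ => ratio π μ (s (n + τ)) (a (n + τ))) b
    let δ := M.r (s (n + b)) (a (n + b)) + M.γ * inner ℝ θ (φ (s (n + b + 1)))
      - inner ℝ θ (φ (s (n + b)))
    projBall B (θ + (η t * F * ratio π μ (s (n + b)) (a (n + b)) * δ) • φ (s (n + b)))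

/-- `‖θ_T - θ*‖²` for PER-ETD(0) with period length `b`, the prescribed stepsizes and the
prescribed projection ball, run along the trajectory `X`. -/
def Trajectory.sqError {M : MDP S A} {μ : Policy S A} (X : Trajectory.{u, v, w} M μ) (π : Policy S A)
    (φ : S → EuclideanSpace ℝ (Fin d)) (f : S → ℝ) (b T : ℕ) (ω : X.Ω) : ℝ :=
  ‖iterate M π μ φ (Btheta M π φ f) (stepsize M π φ f) b (fun k => X.s k ω) (fun k => X.a k ω) T
    - thetaStar M π φ f‖ ^ 2

/-- `E ‖θ_T - θ*‖² ≤ ε` along the trajectory `X` (the expectation being that of an integrable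
random variable). -/
def Trajectory.Accurate {M : MDP S A} {μ : Policy S A} (X : Trajectory.{u, v, w} M μ) (π : Policy S A)
    (φ : S → EuclideanSpace ℝ (Fin d)) (f : S → ℝ) (b T : ℕ) (ε : ℝ) : Prop :=
  Integrable (X.sqError π φ f b T) X.Pr ∧ ∫ ω, X.sqError π φ f b T ω ∂X.Pr ≤ ε

end

end PerETD

open PerETD

/-! PER-ETD(0) is projected stochastic approximation for the linear equation `K θ = Φᵀ F r_π`. The
truncated trace makes the update biased. Its second moment may grow with the period `b`, and the two
effects are traded against each other.

Monotonicity. The emphatic weights solve `f = γ f P_π + d_μ`. Together with `2xy ≤ x² + y²` this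
makes the quadratic form of `diag f (1 - γ P_π)` at least that of `diag d_μ / 2`
(`IsEmphasis.quadForm_ge`). Since `d_μ > 0` and the features are independent, `K` is positive
definite, which gives `μ₀ > 0` and the bound on `θ*`.

Bias. Averaging the trace restarted at time `n` gives a matrix recursion `U_{b+1} = γ U_b P_π +
P_μ^{b+1}` (`traceKernel`, `Trajectory.integral_trace_mul`). Subtracting the equation for `f` and
using the mixing of `P_μ` shows that each row of `U_b` is within a multiple of `ξ^b` of `f` in `ℓ¹`
(`sum_abs_traceKernel_sub_le`). This holds conditionally on the past, so successive periods need not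
be independent.

Variance. Coverage gives `E_μ[ρ² | s] = E_π[ρ | s] ≤ ρ_max`, so the second moment of the trace
satisfies `V_{b+1} = q V_b + c` with `q = γ² ρ_max` (`Trajectory.integral_trace_sq_le`). It is
linear in `b` if `q ≤ 1` and of order `q^b` otherwise.

Rates. The projection does not increase the distance to `θ*`, so one period contracts the mean
squared error by `1 - 2/(t + t₀)`, up to bias and variance terms (`Trajectory.integral_update_le`).
Solving this recursion (`le_add_div_of_recursion`) gives an error of order `(ξ^b)² + V_b / T` for
every `b` and `T` (`exists_accurate`). The prescribed periods then give the rates; for `q > 1` the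
period makes both `ξ^b` and `q^b / T` of order `T^{-a}`. Inverting the rates gives the sample
complexities. -/

namespace PerETD

set_option linter.unusedSectionVars false

/-! ### Finite Markov chains: primitivity, stationary distribution, geometric mixing. -/

section MarkovChain

variable {S : Type*} [Fintype S] [DecidableEq S]

theorem sum_vecMul_of_rowStochastic {P : Matrix S S ℝ} (hP : P ∈ rowStochastic ℝ S) (v : S → ℝ) :
    ∑ j, (v ᵥ* P) j = ∑ i, v i := by
  simp only [vecMul, dotProduct]
  rw [Finset.sum_comm]
  refine Finset.sum_congr rfl fun i _ => ?_
  rw [← Finset.mul_sum, sum_row_of_mem_rowStochastic hP, mul_one]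

theorem sum_abs_vecMul_le {P : Matrix S S ℝ} (h0 : ∀ i j, 0 ≤ P i j) {c : ℝ}
    (hc : ∀ i, ∑ j, P i j = c) (v : S → ℝ) :
    ∑ j, |(v ᵥ* P) j| ≤ c * ∑ i, |v i| := by
  calc ∑ j, |(v ᵥ* P) j| ≤ ∑ j, ∑ i, |v i| * P i j := by
        refine Finset.sum_le_sum fun j _ => ?_
        simp only [vecMul, dotProduct]
        refine (Finset.abs_sum_le_sum_abs _ _).trans (Finset.sum_le_sum fun i _ => ?_)
        rw [abs_mul, abs_of_nonneg (h0 i j)]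
    _ = c * ∑ i, |v i| := by
        rw [Finset.sum_comm, Finset.mul_sum]
        refine Finset.sum_congr rfl fun i _ => ?_
        rw [← Finset.mul_sum, hc, mul_comm]

theorem sum_abs_vecMul_le_of_rowStochastic {P : Matrix S S ℝ} (hP : P ∈ rowStochastic ℝ S)
    (v : S → ℝ) : ∑ j, |(v ᵥ* P) j| ≤ ∑ i, |v i| := by
  simpa using sum_abs_vecMul_le (fun i j => nonneg_of_mem_rowStochastic hP)
    (fun i => sum_row_of_mem_rowStochastic hP i) v

theorem pow_add_apply_pos {P : Matrix S S ℝ} (h0 : ∀ i j, 0 ≤ P i j) {m n : ℕ} {i j k : S}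
    (hm : 0 < (P ^ m) i j) (hn : 0 < (P ^ n) j k) : 0 < (P ^ (m + n)) i k := by
  rw [pow_add, mul_apply]
  exact Finset.sum_pos' (fun l _ => mul_nonneg (pow_apply_nonneg h0 m i l)
    (pow_apply_nonneg h0 n l k)) ⟨j, Finset.mem_univ j, mul_pos hm hn⟩

/-- Return times of an aperiodic chain contain all large integers. -/
theorem IsAperiodic.eventually_pow_apply_pos {P : Matrix S S ℝ} (haper : IsAperiodic P)
    (h0 : ∀ i j, 0 ≤ P i j) (s : S) : ∃ N, ∀ n ≥ N, 0 < (P ^ n) s s := by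
  set R : Set ℕ := {n | 0 < n ∧ 0 < (P ^ n) s s} with hR
  have hgcd : Nat.setGcd R = 1 :=
    haper s _ fun n hn hpos => Nat.setGcd_dvd_of_mem (s := R) ⟨hn, hpos⟩
  -- All large multiples of the gcd lie in the additive monoid generated by the return times. The
  -- return times are closed under addition, so generating adds nothing but zero.
  obtain ⟨N, hN⟩ := Nat.exists_mem_closure_of_ge R
  refine ⟨N, fun n hn => ?_⟩
  have hmem := hN n hn (hgcd ▸ one_dvd n)
  clear hn
  induction hmem using AddSubmonoid.closure_induction with
  | mem x hx => exact hx.2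
  | zero => simp
  | add x y _ _ hx hy => exact pow_add_apply_pos h0 hx hy

/-- An irreducible aperiodic chain on a finite state space is primitive. -/
theorem isPrimitive_of_isIrreducible_of_isAperiodic {P : Matrix S S ℝ} (hirr : P.IsIrreducible)
    (haper : IsAperiodic P) : P.IsPrimitive := by
  have h0 := hirr.nonneg
  refine ⟨h0, ?_⟩
  choose k _ hk using (isIrreducible_iff_exists_pow_pos h0).1 hirr
  choose N hN using haper.eventually_pow_apply_pos h0
  -- One exponent for all pairs: it exceeds every `N i + k i j`, so a path can loop at `i` long
  -- enough and then move to `j`.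
  refine ⟨(∑ i, N i) + (∑ i, ∑ j, k i j) + 1, by omega, fun i j => ?_⟩
  have h1 : N i ≤ ∑ i, N i := Finset.single_le_sum (fun _ _ => Nat.zero_le _) (Finset.mem_univ i)
  have h2 : k i j ≤ ∑ i, ∑ j, k i j :=
    (Finset.single_le_sum (f := fun j => k i j) (fun _ _ => Nat.zero_le _) (Finset.mem_univ j)).trans
      (Finset.single_le_sum (f := fun i => ∑ j, k i j) (fun _ _ => Nat.zero_le _)
        (Finset.mem_univ i))
  obtain ⟨m, hm, hmN⟩ : ∃ m, (∑ i, N i) + (∑ i, ∑ j, k i j) + 1 = m + k i j ∧ N i ≤ m :=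
    ⟨(∑ i, N i) + (∑ i, ∑ j, k i j) + 1 - k i j, by omega, by omega⟩
  rw [hm]
  exact pow_add_apply_pos h0 (hN i m hmN) (hk i j)

/-- A positive stochastic matrix contracts the `ℓ¹` norm on vectors of total mass zero. -/
theorem exists_sum_abs_vecMul_le_of_pos [Nonempty S] {Q : Matrix S S ℝ}
    (hQ : Q ∈ rowStochastic ℝ S) (hpos : ∀ i j, 0 < Q i j) :
    ∃ c : ℝ, 0 < c ∧ c < 1 ∧ ∀ v : S → ℝ, ∑ i, v i = 0 →
      ∑ j, |(v ᵥ* Q) j| ≤ c * ∑ i, |v i| := by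
  obtain ⟨p, hp⟩ := Finite.exists_min fun p : S × S => Q p.1 p.2
  -- Half of the least entry: with the full minimum the contraction factor could be zero, while a
  -- positive factor is needed for its roots and its inverse.
  set δ := Q p.1 p.2 / 2 with hδ
  have hδ0 : 0 < δ := half_pos (hpos _ _)
  have hle : ∀ i j, 2 * δ ≤ Q i j := fun i j => by simpa [hδ, mul_div_cancel₀] using hp (i, j)
  have hcard : (0 : ℝ) < Fintype.card S := by exact_mod_cast Fintype.card_pos
  refine ⟨1 - Fintype.card S * δ, ?_, by nlinarith, fun v hv => ?_⟩
  · have : ∑ j : S, 2 * δ ≤ ∑ j, Q p.1 j := Finset.sum_le_sum fun j _ => hle _ j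
    rw [sum_row_of_mem_rowStochastic hQ] at this
    simp at this
    nlinarith
  · have hvQ : v ᵥ* Q = v ᵥ* (Q - Matrix.of fun _ _ => δ) := by
      rw [vecMul_sub]
      ext j
      simp [vecMul, dotProduct, ← Finset.sum_mul, hv]
    rw [hvQ]
    refine sum_abs_vecMul_le (fun i j => ?_) (fun i => ?_) v
    · simp only [Matrix.sub_apply, of_apply]; linarith [hle i j]
    · simp [sum_row_of_mem_rowStochastic hQ]

/-- Some power `P ^ N` is positive and contracts by a factor `c`. Taking `χ = c^{1/N}` spreads this
over single steps, and the prefactor `1/c` pays for the incomplete last block. -/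
theorem exists_geometric_vecMul_pow [Nonempty S] {P : Matrix S S ℝ} (hP : P ∈ rowStochastic ℝ S)
    (hprim : P.IsPrimitive) :
    ∃ C χ : ℝ, 0 ≤ C ∧ 0 < χ ∧ χ < 1 ∧ ∀ v : S → ℝ, ∑ i, v i = 0 → ∀ t : ℕ,
      ∑ j, |(v ᵥ* P ^ t) j| ≤ C * χ ^ t * ∑ i, |v i| := by
  obtain ⟨N, hN, hpos⟩ := hprim.exists_pos_pow
  obtain ⟨c, hc0, hc1, hc⟩ := exists_sum_abs_vecMul_le_of_pos (pow_mem hP N) hpos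
  have hN' : (N : ℝ) ≠ 0 := by positivity
  set χ : ℝ := c ^ (1 / N : ℝ) with hχ
  have hχ0 : 0 < χ := Real.rpow_pos_of_pos hc0 _
  have hχ1 : χ < 1 := Real.rpow_lt_one hc0.le hc1 (by positivity)
  have hχN : χ ^ N = c := by
    rw [hχ, ← Real.rpow_natCast, ← Real.rpow_mul hc0.le, one_div_mul_cancel hN', Real.rpow_one]
  refine ⟨1 / c, χ, by positivity, hχ0, hχ1, fun v hv t => ?_⟩
  have key : ∀ q : ℕ, ∑ j, |(v ᵥ* P ^ (N * q)) j| ≤ c ^ q * ∑ i, |v i| := by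
    intro q
    induction q with
    | zero => simp
    | succ q ih =>
      rw [mul_add, mul_one, pow_add, ← vecMul_vecMul]
      refine (hc _ ?_).trans ?_
      · rw [sum_vecMul_of_rowStochastic (pow_mem hP _), hv]
      · rw [pow_succ', mul_assoc]
        exact mul_le_mul_of_nonneg_left ih hc0.le
  have hs : 0 ≤ ∑ i, |v i| := Finset.sum_nonneg fun _ _ => abs_nonneg _
  rw [← Nat.div_add_mod t N, pow_add, ← vecMul_vecMul]
  refine (sum_abs_vecMul_le_of_rowStochastic (pow_mem hP _) _).trans ((key _).trans ?_)
  refine mul_le_mul_of_nonneg_right ?_ hs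
  rw [pow_add, pow_mul, hχN]
  have hr : c ≤ χ ^ (t % N) := by
    rw [← hχN]
    exact pow_le_pow_of_le_one hχ0.le hχ1.le (Nat.mod_lt _ hN).le
  rw [one_div, ← div_eq_inv_mul, le_div_iff₀ hc0]
  exact mul_le_mul_of_nonneg_left hr (by positivity)

theorem vecMul_pow_eq {P : Matrix S S ℝ} {d : S → ℝ} (h : d ᵥ* P = d) (t : ℕ) :
    d ᵥ* P ^ t = d := by
  induction t with
  | zero => simp
  | succ t ih => rw [pow_succ, ← vecMul_vecMul, ih, h]

theorem eq_zero_of_vecMul_eq [Nonempty S] {P : Matrix S S ℝ} (hP : P ∈ rowStochastic ℝ S)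
    (hprim : P.IsPrimitive) {v : S → ℝ} (hv : v ᵥ* P = v) (hsum : ∑ i, v i = 0) : v = 0 := by
  obtain ⟨N, hN, hpos⟩ := hprim.exists_pos_pow
  obtain ⟨c, hc0, hc1, hc⟩ := exists_sum_abs_vecMul_le_of_pos (pow_mem hP N) hpos
  have h := hc v hsum
  rw [vecMul_pow_eq hv] at h
  have h0 : ∑ i, |v i| = 0 :=
    le_antisymm (by nlinarith) (Finset.sum_nonneg fun _ _ => abs_nonneg _)
  rw [Finset.sum_eq_zero_iff_of_nonneg fun _ _ => abs_nonneg _] at h0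
  ext i
  simpa using h0 i (Finset.mem_univ i)

/-- A primitive stochastic matrix has a positive stationary distribution, to which the chain
converges geometrically fast. -/
theorem exists_isStationaryDist [Nonempty S] {P : Matrix S S ℝ} (hP : P ∈ rowStochastic ℝ S)
    (hprim : P.IsPrimitive) :
    ∃ d : S → ℝ, IsStationaryDist P d ∧ (∀ d', IsStationaryDist P d' → d' = d) ∧ (∀ s, 0 < d s) ∧
      ∃ C χ : ℝ, IsGeometricRate P d C χ := by
  -- The constant vector is a right null vector of `P - 1`, so the determinant vanishes and a left
  -- null vector exists. Its mass is nonzero by contraction, so it can be normalized.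
  obtain ⟨v, hv0, hv⟩ : ∃ v ≠ (0 : S → ℝ), v ᵥ* (P - 1) = 0 := by
    rw [exists_vecMul_eq_zero_iff, ← exists_mulVec_eq_zero_iff]
    refine ⟨1, one_ne_zero, ?_⟩
    rw [sub_mulVec, one_vecMul_of_mem_rowStochastic hP, one_mulVec, sub_self]
  rw [vecMul_sub, vecMul_one, sub_eq_zero] at hv
  have hsum : ∑ i, v i ≠ 0 := fun h => hv0 (eq_zero_of_vecMul_eq hP hprim hv h)
  set d : S → ℝ := (∑ i, v i)⁻¹ • v with hd
  have hdP : d ᵥ* P = d := by rw [hd, smul_vecMul, hv]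
  have hd1 : ∑ i, d i = 1 := by
    simp only [hd, Pi.smul_apply, smul_eq_mul, ← Finset.mul_sum]
    exact inv_mul_cancel₀ hsum
  obtain ⟨C, χ, hC, hχ0, hχ1, hgeo⟩ := exists_geometric_vecMul_pow hP hprim
  have hrow : ∀ i t, (Pi.single i 1 - d) ᵥ* P ^ t = fun j => (P ^ t) i j - d j := by
    intro i t
    rw [sub_vecMul, vecMul_pow_eq hdP, single_one_vecMul]
    rfl
  have hrate : ∀ i t, ∑ j, |(P ^ t) i j - d j| ≤ C * χ ^ t * ∑ j, |(Pi.single i 1 - d : S → ℝ) j| := by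
    intro i t
    have := hgeo (Pi.single i 1 - d) (by simp [hd1]) t
    rwa [hrow] at this
  set D : ℝ := ∑ i, ∑ j, |(Pi.single i 1 - d : S → ℝ) j| with hD
  have hDi : ∀ i, ∑ j, |(Pi.single i 1 - d : S → ℝ) j| ≤ D := fun i =>
    Finset.single_le_sum (f := fun i => ∑ j, |(Pi.single i 1 - d : S → ℝ) j|)
      (fun _ _ => Finset.sum_nonneg fun _ _ => abs_nonneg _) (Finset.mem_univ i)
  have hD0 : 0 ≤ D := Finset.sum_nonneg fun _ _ => Finset.sum_nonneg fun _ _ => abs_nonneg _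
  have hG : IsGeometricRate P d (C * D) χ := by
    refine ⟨by positivity, hχ0, hχ1, fun i t => (hrate i t).trans ?_⟩
    calc C * χ ^ t * ∑ j, |(Pi.single i 1 - d : S → ℝ) j| ≤ C * χ ^ t * D :=
          mul_le_mul_of_nonneg_left (hDi i) (by positivity)
      _ = _ := by ring
  -- The null vector carries no sign information; nonnegativity comes from `d` being a limit of rows
  -- of `P ^ t`.
  have hnonneg : ∀ s, 0 ≤ d s := by
    intro s
    have hlim : Tendsto (fun t : ℕ => C * D * χ ^ t) atTop (𝓝 0) := by
      simpa using (tendsto_pow_atTop_nhds_zero_of_lt_one hχ0.le hχ1).const_mul (C * D)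
    have : ∀ t : ℕ, -d s ≤ C * D * χ ^ t := fun t => by
      have h1 := (Finset.single_le_sum (f := fun j => |(P ^ t) s j - d j|)
        (fun _ _ => abs_nonneg _) (Finset.mem_univ s)).trans (hG.bound s t)
      have h2 := nonneg_of_mem_rowStochastic (pow_mem hP t) (i := s) (j := s)
      linarith [le_abs_self ((P ^ t) s s - d s)]
    linarith [ge_of_tendsto' hlim this]
  refine ⟨d, ⟨hnonneg, hd1, hdP⟩, fun d' hd' => ?_, fun s => ?_, _, _, hG⟩
  · refine sub_eq_zero.1 (eq_zero_of_vecMul_eq hP hprim ?_ ?_)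
    · rw [sub_vecMul, hd'.stationary, hdP]
    · simp [hd1, hd'.sum_eq_one]
  · obtain ⟨N, hN, hpos⟩ := hprim.exists_pos_pow
    rw [← vecMul_pow_eq hdP N]
    obtain ⟨i, hi⟩ : ∃ i, 0 < d i := by
      by_contra! h
      have : ∑ i, d i ≤ 0 := Finset.sum_nonpos fun i _ => h i
      linarith
    exact Finset.sum_pos' (fun l _ => mul_nonneg (hnonneg l) (hpos l s).le)
      ⟨i, Finset.mem_univ i, mul_pos hi (hpos i s)⟩

theorem IsGeometricRate.mono {P : Matrix S S ℝ} {d : S → ℝ} {C χ χ' : ℝ}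
    (h : IsGeometricRate P d C χ) (hle : χ ≤ χ') (h1 : χ' < 1) : IsGeometricRate P d C χ' :=
  ⟨h.C_nonneg, h.χ_pos.trans_le hle, h1, fun s t => (h.bound s t).trans
    (mul_le_mul_of_nonneg_left (pow_le_pow_left₀ h.χ_pos.le hle t) h.C_nonneg)⟩

end MarkovChain

open scoped Matrix.Norms.L2Operator

/-! ### Emphatic weights and convergence of the expected trace. -/

section Emphasis

variable {S : Type*} [Fintype S] [DecidableEq S]

/-- The emphatic weights `f = γ f P + d`. -/
structure IsEmphasis (γ : ℝ) (P : Matrix S S ℝ) (d f : S → ℝ) : Prop where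
  pos : ∀ s, 0 < f s
  fixed : ∀ j, f j = γ * (f ᵥ* P) j + d j
  sum_eq : ∑ s, f s = 1 / (1 - γ)

/-- A stochastic matrix does not increase the `ℓ¹` norm of row vectors, so `1 - γ P` has no left
kernel. Positivity is obtained without a Neumann series, by comparing the sum of `f` with its `ℓ¹`
norm. -/
theorem exists_isEmphasis {γ : ℝ} (h0 : 0 ≤ γ) (h1 : γ < 1) {P : Matrix S S ℝ}
    (hP : P ∈ rowStochastic ℝ S) {d : S → ℝ} (hd : ∀ s, 0 < d s) (hd1 : ∑ s, d s = 1) :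
    ∃ f, IsEmphasis γ P d f := by
  have hdet : (1 - γ • P).det ≠ 0 := by
    intro h
    obtain ⟨v, hv0, hv⟩ := exists_vecMul_eq_zero_iff.2 h
    rw [vecMul_sub, vecMul_one, sub_eq_zero, vecMul_smul] at hv
    have hle : ∑ i, |v i| ≤ γ * ∑ i, |v i| := by
      conv_lhs => rw [hv]
      simp only [Pi.smul_apply, smul_eq_mul, abs_mul, abs_of_nonneg h0, ← Finset.mul_sum]
      exact mul_le_mul_of_nonneg_left (sum_abs_vecMul_le_of_rowStochastic hP v) h0
    have hs : ∑ i, |v i| = 0 :=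
      le_antisymm (by nlinarith) (Finset.sum_nonneg fun _ _ => abs_nonneg _)
    rw [Finset.sum_eq_zero_iff_of_nonneg fun _ _ => abs_nonneg _] at hs
    exact hv0 (funext fun i => by simpa using hs i (Finset.mem_univ i))
  set f : S → ℝ := d ᵥ* (1 - γ • P)⁻¹ with hf
  have hfix : ∀ j, f j = γ * (f ᵥ* P) j + d j := by
    have : f ᵥ* (1 - γ • P) = d := by
      rw [hf, vecMul_vecMul, nonsing_inv_mul _ (isUnit_iff_ne_zero.2 hdet), vecMul_one]
    intro j
    have := congrFun this j
    rw [vecMul_sub, vecMul_one, vecMul_smul] at this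
    simp only [Pi.sub_apply, Pi.smul_apply, smul_eq_mul] at this
    linarith
  have hsum : ∑ s, f s = 1 / (1 - γ) := by
    have : ∑ s, f s = γ * ∑ s, f s + 1 := by
      conv_lhs => rw [Finset.sum_congr rfl fun j _ => hfix j]
      rw [Finset.sum_add_distrib, ← Finset.mul_sum, sum_vecMul_of_rowStochastic hP, hd1]
    rw [eq_div_iff (by linarith)]
    linarith
  -- The triangle inequality in the fixed point equation bounds the `ℓ¹` norm by `1/(1 - γ)`, which
  -- is the sum of `f` itself. Hence no entry is negative.
  have habs : ∑ s, |f s| ≤ ∑ s, f s := by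
    have h2 : ∑ s, |f s| ≤ γ * ∑ s, |f s| + 1 := by
      calc ∑ s, |f s| ≤ ∑ s, (γ * |(f ᵥ* P) s| + d s) := by
            refine Finset.sum_le_sum fun j _ => ?_
            conv_lhs => rw [hfix j]
            refine (abs_add_le _ _).trans ?_
            rw [abs_mul, abs_of_nonneg h0, abs_of_pos (hd j)]
        _ ≤ γ * ∑ s, |f s| + 1 := by
            rw [Finset.sum_add_distrib, ← Finset.mul_sum, hd1]
            have := mul_le_mul_of_nonneg_left (sum_abs_vecMul_le_of_rowStochastic hP f) h0
            linarith
    rw [hsum, le_div_iff₀ (by linarith)]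
    linarith
  have hnn : ∀ s, 0 ≤ f s := by
    intro s
    have h3 : ∑ s, (|f s| - f s) ≤ 0 := by rw [Finset.sum_sub_distrib]; linarith
    have h4 : |f s| - f s ≤ 0 := (Finset.single_le_sum (f := fun s => |f s| - f s)
      (fun i _ => sub_nonneg.2 (le_abs_self _)) (Finset.mem_univ s)).trans h3
    linarith [abs_nonneg (f s)]
  refine ⟨f, fun s => ?_, hfix, hsum⟩
  rw [hfix s]
  have : 0 ≤ (f ᵥ* P) s :=
    Finset.sum_nonneg fun i _ => mul_nonneg (hnn i) (nonneg_of_mem_rowStochastic hP)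
  have := hd s
  positivity

/-- The quadratic form of `diag f (1 - γ P)` dominates that of `diag d / 2`. -/
theorem IsEmphasis.quadForm_ge {γ : ℝ} (h0 : 0 ≤ γ) (h1 : γ < 1) {P : Matrix S S ℝ}
    (hP : P ∈ rowStochastic ℝ S) {d f : S → ℝ} (h : IsEmphasis γ P d f) (y : S → ℝ) :
    ∑ s, d s * y s ^ 2 / 2 ≤ ∑ s, f s * y s * (y s - γ * (P *ᵥ y) s) := by
  have e1 : ∑ s, f s * y s * (y s - γ * (P *ᵥ y) s) =
      ∑ s, f s * y s ^ 2 - γ * ∑ s, ∑ k, f s * P s k * (y s * y k) := by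
    rw [Finset.mul_sum, ← Finset.sum_sub_distrib]
    refine Finset.sum_congr rfl fun s _ => ?_
    simp only [mulVec, dotProduct]
    rw [mul_sub, Finset.mul_sum, Finset.mul_sum, Finset.mul_sum]
    congr 1
    · ring
    · exact Finset.sum_congr rfl fun k _ => by ring
  -- Only the cross terms are estimated. Of the resulting halves, the one carrying `f P` is turned
  -- by the fixed point equation into `f - d`, which produces the `d` term; what is left over is `(1
  -- - γ)/2 · ∑ f y²`.
  have e2 : ∑ s, ∑ k, f s * P s k * (y s * y k) ≤
      ∑ s, ∑ k, (f s * P s k * (y s ^ 2 / 2) + f s * P s k * (y k ^ 2 / 2)) := by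
    refine Finset.sum_le_sum fun s _ => Finset.sum_le_sum fun k _ => ?_
    have : 0 ≤ f s * P s k := mul_nonneg (h.pos s).le (nonneg_of_mem_rowStochastic hP)
    nlinarith [sq_nonneg (y s - y k)]
  have e3 : ∑ s, ∑ k, (f s * P s k * (y s ^ 2 / 2) + f s * P s k * (y k ^ 2 / 2)) =
      ∑ s, f s * y s ^ 2 / 2 + ∑ k, (f ᵥ* P) k * (y k ^ 2 / 2) := by
    simp only [Finset.sum_add_distrib]
    congr 1
    · refine Finset.sum_congr rfl fun s _ => ?_
      rw [← Finset.sum_mul, ← Finset.mul_sum, sum_row_of_mem_rowStochastic hP]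
      ring
    · rw [Finset.sum_comm]
      refine Finset.sum_congr rfl fun s _ => ?_
      simp only [vecMul, dotProduct, Finset.sum_mul]
  have e4 : γ * ∑ k, (f ᵥ* P) k * (y k ^ 2 / 2) = ∑ k, f k * y k ^ 2 / 2 - ∑ k, d k * y k ^ 2 / 2 := by
    rw [Finset.mul_sum, ← Finset.sum_sub_distrib]
    refine Finset.sum_congr rfl fun k _ => ?_
    have := h.fixed k
    rw [← mul_assoc, eq_sub_of_add_eq this.symm]
    ring
  have e5 : 0 ≤ ∑ s, f s * y s ^ 2 / 2 :=
    Finset.sum_nonneg fun s _ => by have := h.pos s; positivity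
  have e6 : ∑ s, f s * y s ^ 2 = 2 * ∑ s, f s * y s ^ 2 / 2 := by
    rw [Finset.mul_sum]; exact Finset.sum_congr rfl fun s _ => by ring
  have e7 := mul_le_mul_of_nonneg_left (e2.trans_eq e3) h0
  rw [mul_add, e4] at e7
  rw [e1, e6]
  nlinarith

/-- `traceKernel γ P Q b i j = E[F_b 1{s_b = j} | s_0 = i]`, where `F` is the follow-on trace. -/
def traceKernel (γ : ℝ) (P Q : Matrix S S ℝ) : ℕ → Matrix S S ℝ
  | 0 => 1
  | b + 1 => γ • (traceKernel γ P Q b * P) + Q ^ (b + 1)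

/-- The error row obeys `e_{b+1} = γ e_b P + (Q^{b+1} - d)`. It is thus damped by `γ` and driven by
a term of size `C χ^{b+1}`. -/
theorem sum_abs_traceKernel_sub_le {γ : ℝ} (h0 : 0 < γ) {P Q : Matrix S S ℝ}
    (hP : P ∈ rowStochastic ℝ S) {d f : S → ℝ} (h : IsEmphasis γ P d f) {C χ : ℝ}
    (hG : IsGeometricRate Q d C χ) (hne : χ ≠ γ) (b : ℕ) (i : S) :
    ∑ j, |traceKernel γ P Q b i j - f j| ≤ (C / |χ - γ| + (1 + ∑ s, |f s|)) * max γ χ ^ b := by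
  -- The quotient is the closed form of the convolution of the powers of `γ` and `χ`; this is where
  -- `χ ≠ γ` enters.
  have hstep : ∀ b, ∑ j, |traceKernel γ P Q b i j - f j| ≤
      γ ^ b * (1 + ∑ s, |f s|) + C * χ * ((χ ^ b - γ ^ b) / (χ - γ)) := by
    intro b
    induction b with
    | zero =>
      simp only [traceKernel, pow_zero, one_mul, sub_self, zero_div, mul_zero, add_zero]
      refine (Finset.sum_le_sum fun j _ => abs_sub _ _).trans ?_
      rw [Finset.sum_add_distrib]
      gcongr
      rw [Finset.sum_eq_single i] <;> simp +contextual [one_apply, eq_comm]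
    | succ b ih =>
      have e : ∀ j, traceKernel γ P Q (b + 1) i j - f j =
          γ * ((fun k => traceKernel γ P Q b i k - f k) ᵥ* P) j + ((Q ^ (b + 1)) i j - d j) := by
        intro j
        have h1 : ((fun k => traceKernel γ P Q b i k - f k) ᵥ* P) j =
            (traceKernel γ P Q b * P) i j - (f ᵥ* P) j := by
          simp only [vecMul, dotProduct, mul_apply, sub_mul, Finset.sum_sub_distrib]
        rw [h1]
        conv_lhs => rw [h.fixed j]
        simp only [traceKernel, Matrix.add_apply, Matrix.smul_apply, smul_eq_mul]
        ring
      calc ∑ j, |traceKernel γ P Q (b + 1) i j - f j|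
          ≤ ∑ j, (γ * |((fun k => traceKernel γ P Q b i k - f k) ᵥ* P) j| +
              |(Q ^ (b + 1)) i j - d j|) := by
            refine Finset.sum_le_sum fun j _ => ?_
            rw [e j]
            refine (abs_add_le _ _).trans ?_
            rw [abs_mul, abs_of_pos h0]
        _ ≤ γ * (γ ^ b * (1 + ∑ s, |f s|) + C * χ * ((χ ^ b - γ ^ b) / (χ - γ))) +
              C * χ ^ (b + 1) := by
            rw [Finset.sum_add_distrib, ← Finset.mul_sum]
            gcongr
            · exact (sum_abs_vecMul_le_of_rowStochastic hP _).trans ih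
            · exact hG.bound i (b + 1)
        _ = _ := by
            have : χ - γ ≠ 0 := sub_ne_zero.2 hne
            field_simp
            ring
  refine (hstep b).trans ?_
  have hC := hG.C_nonneg
  have hχ := hG.χ_pos
  have hf : 0 ≤ ∑ s, |f s| := Finset.sum_nonneg fun _ _ => abs_nonneg _
  have hγb : γ ^ b ≤ max γ χ ^ b := pow_le_pow_left₀ h0.le (le_max_left _ _) b
  have hχb : χ ^ b ≤ max γ χ ^ b := pow_le_pow_left₀ hχ.le (le_max_right _ _) b
  have hfrac : (χ ^ b - γ ^ b) / (χ - γ) ≤ max γ χ ^ b / |χ - γ| := by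
    refine (le_abs_self _).trans ?_
    rw [abs_div]
    gcongr
    rw [abs_le]
    constructor <;> linarith [pow_pos h0 b, pow_pos hχ b]
  have hCχ : C * χ ≤ C := by nlinarith [hG.χ_lt_one]
  have hm : 0 ≤ max γ χ ^ b / |χ - γ| := by positivity
  calc _ ≤ max γ χ ^ b * (1 + ∑ s, |f s|) + C * χ * (max γ χ ^ b / |χ - γ|) := by gcongr
    _ ≤ max γ χ ^ b * (1 + ∑ s, |f s|) + C * (max γ χ ^ b / |χ - γ|) := by gcongr
    _ = _ := by ring

end Emphasis

/-! ### The key matrix, its monotonicity constant and the fixed point. -/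

section KeyMatrix

variable {S : Type u} {A : Type v} [Fintype S] [Fintype A] [DecidableEq S]

theorem transMatrix_mem_rowStochastic (M : MDP S A) (π : Policy S A) :
    transMatrix M π ∈ rowStochastic ℝ S := by
  rw [mem_rowStochastic_iff_sum]
  refine ⟨fun i j => Finset.sum_nonneg fun a _ => mul_nonneg (π.nonneg i a) (M.P_nonneg i a j),
    fun i => ?_⟩
  simp only [transMatrix, of_apply]
  rw [Finset.sum_comm]
  simp only [← Finset.mul_sum, M.P_sum, mul_one, π.sum_eq_one]

variable {d : ℕ} (M : MDP S A) (π : Policy S A) (φ : S → EuclideanSpace ℝ (Fin d)) (f : S → ℝ)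

theorem featureMatrix_mulVec (x : EuclideanSpace ℝ (Fin d)) (s : S) :
    (featureMatrix φ *ᵥ x.ofLp) s = inner ℝ x (φ s) := by
  simp [featureMatrix, mulVec, dotProduct, PiLp.inner_apply]

theorem dotProduct_transpose_featureMatrix_diagonal_mulVec (z : EuclideanSpace ℝ (Fin d))
    (r : S → ℝ) :
    z.ofLp ⬝ᵥ (((featureMatrix φ)ᵀ * diagonal f) *ᵥ r) = ∑ s, f s * inner ℝ z (φ s) * r s := by
  rw [← mulVec_mulVec, dotProduct_mulVec, vecMul_transpose]
  simp only [dotProduct, featureMatrix_mulVec, mulVec_diagonal]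
  exact Finset.sum_congr rfl fun s _ => by ring

theorem dotProduct_keyMatrix_mulVec (z x : EuclideanSpace ℝ (Fin d)) :
    z.ofLp ⬝ᵥ (keyMatrix M π φ f *ᵥ x.ofLp) = ∑ s, f s * inner ℝ z (φ s) *
      (inner ℝ x (φ s) - M.γ * (transMatrix M π *ᵥ fun k => inner ℝ x (φ k)) s) := by
  have e : featureMatrix φ *ᵥ x.ofLp = fun k => inner ℝ x (φ k) :=
    funext fun k => featureMatrix_mulVec φ x k
  rw [keyMatrix, ← mulVec_mulVec, ← mulVec_mulVec,
    dotProduct_transpose_featureMatrix_diagonal_mulVec, e]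
  refine Finset.sum_congr rfl fun s _ => ?_
  rw [sub_mulVec, one_mulVec, smul_mulVec]
  simp

variable {M π φ f} {dμ : S → ℝ}

theorem keyMatrix_quadForm_pos (hφ : LinearIndependent ℝ (featureMatrix φ).col)
    (hd : ∀ s, 0 < dμ s) (hf : IsEmphasis M.γ (transMatrix M π) dμ f)
    {x : EuclideanSpace ℝ (Fin d)} (hx : x ≠ 0) :
    0 < x.ofLp ⬝ᵥ (keyMatrix M π φ f *ᵥ x.ofLp) := by
  rw [dotProduct_keyMatrix_mulVec]
  refine lt_of_lt_of_le ?_ (hf.quadForm_ge M.γ_pos.le M.γ_lt_one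
    (transMatrix_mem_rowStochastic M π) fun s => inner ℝ x (φ s))
  obtain ⟨s, hs⟩ : ∃ s, inner ℝ x (φ s) ≠ 0 := by
    by_contra! h
    refine hx ?_
    have h1 : featureMatrix φ *ᵥ x.ofLp = featureMatrix φ *ᵥ 0 := by
      rw [mulVec_zero]
      ext s
      rw [featureMatrix_mulVec, h s]
      rfl
    have h2 := (mulVec_injective_iff.2 hφ) h1
    ext i
    simpa using congrFun h2 i
  exact Finset.sum_pos' (fun s _ => by have := hd s; positivity)
    ⟨s, Finset.mem_univ s, by have := hd s; positivity⟩

theorem isUnit_det_keyMatrix (hφ : LinearIndependent ℝ (featureMatrix φ).col)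
    (hd : ∀ s, 0 < dμ s) (hf : IsEmphasis M.γ (transMatrix M π) dμ f) :
    IsUnit (keyMatrix M π φ f).det := by
  rw [isUnit_iff_ne_zero]
  intro h
  obtain ⟨v, hv0, hv⟩ := exists_mulVec_eq_zero_iff.2 h
  have hne : WithLp.toLp 2 v ≠ 0 := by simpa using hv0
  have := keyMatrix_quadForm_pos hφ hd hf hne
  simp only [hv, dotProduct_zero, lt_self_iff_false] at this

/-- The infimum is attained on the compact unit sphere, hence positive, and homogeneity extends the
bound to all vectors. For `d = 0` the sphere is empty and the infimum takes a default value. -/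
theorem mu0_spec (hφ : LinearIndependent ℝ (featureMatrix φ).col)
    (hd : ∀ s, 0 < dμ s) (hf : IsEmphasis M.γ (transMatrix M π) dμ f) (hd0 : 0 < d) :
    0 < mu0 M π φ f ∧ ∀ x : EuclideanSpace ℝ (Fin d),
      mu0 M π φ f * ‖x‖ ^ 2 ≤ x.ofLp ⬝ᵥ (keyMatrix M π φ f *ᵥ x.ofLp) := by
  have : Nonempty (Fin d) := ⟨⟨0, hd0⟩⟩
  set q : EuclideanSpace ℝ (Fin d) → ℝ := fun x => x.ofLp ⬝ᵥ (keyMatrix M π φ f *ᵥ x.ofLp) with hq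
  have hqc : Continuous q := by
    simp only [hq, dotProduct, mulVec]
    fun_prop
  have hset : {c : ℝ | ∃ x : EuclideanSpace ℝ (Fin d), ‖x‖ = 1 ∧ c = q x} =
      q '' Metric.sphere 0 1 := by
    ext c
    simp [eq_comm]
  have hcomp : IsCompact (q '' Metric.sphere 0 1) := (isCompact_sphere _ _).image hqc
  have hne : (q '' Metric.sphere 0 1).Nonempty :=
    (NormedSpace.sphere_nonempty.2 zero_le_one).image q
  have hmu : mu0 M π φ f = sInf (q '' Metric.sphere 0 1) := by rw [← hset]; rfl
  constructor
  · obtain ⟨x, hx, hxq⟩ := hcomp.sInf_mem hne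
    rw [hmu, ← hxq]
    refine keyMatrix_quadForm_pos hφ hd hf ?_
    rintro rfl
    simp at hx
  · intro x
    rcases eq_or_ne x 0 with rfl | hx
    · simp
    have hxn : 0 < ‖x‖ := norm_pos_iff.2 hx
    have h1 : mu0 M π φ f ≤ q (‖x‖⁻¹ • x) := by
      rw [hmu]
      refine csInf_le hcomp.bddBelow ⟨_, ?_, rfl⟩
      simp [norm_smul, hxn.ne']
    have h2 : q (‖x‖⁻¹ • x) = (‖x‖ ^ 2)⁻¹ * q x := by
      simp only [hq, WithLp.ofLp_smul, mulVec_smul, dotProduct_smul, smul_dotProduct, smul_eq_mul]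
      field_simp
    rw [h2, ← div_eq_inv_mul, le_div_iff₀ (by positivity)] at h1
    exact h1

/-- Cauchy–Schwarz at a unit vector. It ensures `t₀ ≥ 8`, so that the contraction factor of the
recursion is never negative. -/
theorem mu0_le_L0 (hφ : LinearIndependent ℝ (featureMatrix φ).col)
    (hd : ∀ s, 0 < dμ s) (hf : IsEmphasis M.γ (transMatrix M π) dμ f) (hd0 : 0 < d) :
    mu0 M π φ f ≤ L0 M π φ f := by
  have : Nonempty (Fin d) := ⟨⟨0, hd0⟩⟩
  obtain ⟨x, hx⟩ : ∃ x : EuclideanSpace ℝ (Fin d), ‖x‖ = 1 := by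
    obtain ⟨x, hx⟩ := (NormedSpace.sphere_nonempty (x := (0 : EuclideanSpace ℝ (Fin d)))).2
      zero_le_one
    exact ⟨x, by simpa using hx⟩
  have h := (mu0_spec hφ hd hf hd0).2 x
  rw [hx, one_pow, mul_one] at h
  refine h.trans ?_
  have h2 := Matrix.l2_opNorm_mulVec (keyMatrix M π φ f) x
  rw [hx, mul_one] at h2
  refine le_trans ?_ h2
  have h3 := real_inner_le_norm (WithLp.toLp 2 (keyMatrix M π φ f *ᵥ x.ofLp)) x
  rw [hx, mul_one] at h3
  refine le_trans (le_of_eq ?_) h3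
  simp [PiLp.inner_apply, dotProduct]

theorem keyMatrix_mulVec_thetaStar (hu : IsUnit (keyMatrix M π φ f).det) :
    keyMatrix M π φ f *ᵥ (thetaStar M π φ f).ofLp =
      ((featureMatrix φ)ᵀ * diagonal f) *ᵥ meanReward M π := by
  rw [thetaStar, mulVec_mulVec, mul_nonsing_inv _ hu, one_mulVec]

theorem abs_r_le_rMax (s : S) (a : A) : |M.r s a| ≤ rMax M :=
  le_ciSup (f := fun p : S × A => |M.r p.1 p.2|) (Set.finite_range _).bddAbove (s, a)

theorem rMax_nonneg (M : MDP S A) : 0 ≤ rMax M := Real.iSup_nonneg fun _ => abs_nonneg _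

theorem norm_le_Bphi (φ : S → EuclideanSpace ℝ (Fin d)) (s : S) : ‖φ s‖ ≤ Bphi φ :=
  le_ciSup (f := fun s => ‖φ s‖) (Set.finite_range _).bddAbove s

theorem Bphi_nonneg (φ : S → EuclideanSpace ℝ (Fin d)) : 0 ≤ Bphi φ :=
  Real.iSup_nonneg fun _ => norm_nonneg _

theorem abs_meanReward_le (s : S) : |meanReward M π s| ≤ rMax M := by
  calc |meanReward M π s| ≤ ∑ a, |M.r s a * π.prob s a| := Finset.abs_sum_le_sum_abs _ _
    _ ≤ ∑ a, rMax M * π.prob s a := by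
        refine Finset.sum_le_sum fun a _ => ?_
        rw [abs_mul, abs_of_nonneg (π.nonneg s a)]
        exact mul_le_mul_of_nonneg_right (abs_r_le_rMax s a) (π.nonneg s a)
    _ = rMax M := by rw [← Finset.mul_sum, π.sum_eq_one, mul_one]

/-- Test the equation for `θ*` against `θ*` itself: `μ₀ ‖θ*‖² ≤ ‖θ*‖ ‖Φᵀ‖ ‖F r_π‖`. The last norm is
at most the `ℓ¹` norm, and the total mass of `f` is `1/(1 - γ)`. -/
theorem norm_thetaStar_le (hφ : LinearIndependent ℝ (featureMatrix φ).col)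
    (hd : ∀ s, 0 < dμ s) (hf : IsEmphasis M.γ (transMatrix M π) dμ f) :
    ‖thetaStar M π φ f‖ ≤ Btheta M π φ f := by
  rcases Nat.eq_zero_or_pos d with rfl | hd0
  · have h1 : (featureMatrix φ)ᵀ = 0 := Subsingleton.elim _ _
    have h2 : thetaStar M π φ f = 0 := Subsingleton.elim _ _
    rw [h2, Btheta, h1]
    simp
  obtain ⟨hmu, hquad⟩ := mu0_spec hφ hd hf hd0
  set θ := thetaStar M π φ f with hθ
  set N := ‖(featureMatrix φ)ᵀ‖ with hN
  have hγ : 0 < 1 - M.γ := by linarith [M.γ_lt_one]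
  rcases eq_or_ne θ 0 with h0 | hne
  · rw [h0, norm_zero]
    exact div_nonneg (mul_nonneg (norm_nonneg _) (rMax_nonneg M)) (by positivity)
  have hθn : 0 < ‖θ‖ := norm_pos_iff.2 hne
  have h1 := hquad θ
  rw [keyMatrix_mulVec_thetaStar (isUnit_det_keyMatrix hφ hd hf), ← mulVec_mulVec] at h1
  set g : EuclideanSpace ℝ S := WithLp.toLp 2 (diagonal f *ᵥ meanReward M π) with hg
  have h2 := Matrix.l2_opNorm_mulVec (featureMatrix φ)ᵀ g
  have h3 : ‖g‖ ≤ rMax M / (1 - M.γ) := by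
    have : ‖g‖ ≤ ∑ s, |g s| := by
      rw [EuclideanSpace.norm_eq]
      refine Real.sqrt_le_iff.2 ⟨Finset.sum_nonneg fun _ _ => abs_nonneg _, ?_⟩
      simp only [Real.norm_eq_abs]
      exact Finset.sum_sq_le_sq_sum_of_nonneg fun _ _ => abs_nonneg _
    refine this.trans ?_
    calc ∑ s, |g s| ≤ ∑ s, f s * rMax M := by
          refine Finset.sum_le_sum fun s _ => ?_
          simp only [hg, mulVec_diagonal, abs_mul, abs_of_pos (hf.pos s)]
          exact mul_le_mul_of_nonneg_left (abs_meanReward_le s) (hf.pos s).le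
      _ = _ := by rw [← Finset.sum_mul, hf.sum_eq]; ring
  have h4 : θ.ofLp ⬝ᵥ ((featureMatrix φ)ᵀ *ᵥ diagonal f *ᵥ meanReward M π) ≤
      ‖θ‖ * (N * (rMax M / (1 - M.γ))) := by
    have h5 := real_inner_le_norm θ (WithLp.toLp 2 ((featureMatrix φ)ᵀ *ᵥ g.ofLp))
    have h6 : inner ℝ θ (WithLp.toLp 2 ((featureMatrix φ)ᵀ *ᵥ g.ofLp)) =
        θ.ofLp ⬝ᵥ ((featureMatrix φ)ᵀ *ᵥ diagonal f *ᵥ meanReward M π) := by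
      simp [PiLp.inner_apply, dotProduct, hg, mul_comm]
    rw [← h6]
    refine h5.trans (mul_le_mul_of_nonneg_left (h2.trans ?_) (norm_nonneg _))
    exact mul_le_mul_of_nonneg_left h3 (norm_nonneg _)
  have h7 := h1.trans h4
  rw [pow_two, mul_left_comm, mul_le_mul_iff_right₀ hθn] at h7
  rw [Btheta, le_div_iff₀ (by positivity)]
  rw [mul_div_assoc', le_div_iff₀ hγ] at h7
  nlinarith

end KeyMatrix

/-! ### Random variables that factor through a finite-valued map. -/

section FiniteRange

variable {Ω ι : Type*} [MeasurableSpace Ω] [Fintype ι] {Pr : Measure Ω} {H : Ω → ι}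

/-- Every preimage is a finite union of fibers. With the next lemma, this makes any function of a
finite history measurable and integrable. -/
theorem measurable_of_factorsThrough (hH : ∀ h, MeasurableSet {ω | H ω = h}) {G : Ω → ℝ}
    (hG : ∀ ω ω', H ω = H ω' → G ω = G ω') : Measurable G := by
  intro B _
  have : G ⁻¹' B = ⋃ h ∈ H '' (G ⁻¹' B), {ω | H ω = h} := by
    ext ω
    simp only [Set.mem_preimage, Set.mem_iUnion, Set.mem_image, Set.mem_ofPred_eq, exists_prop]
    constructor
    · exact fun h => ⟨H ω, ⟨ω, h, rfl⟩, rfl⟩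
    · rintro ⟨_, ⟨ω', h', rfl⟩, h⟩
      rw [hG ω ω' h]
      exact h'
  rw [this]
  exact MeasurableSet.biUnion (Set.to_countable _) fun h _ => hH h

theorem integrable_of_factorsThrough [IsFiniteMeasure Pr] (hH : ∀ h, MeasurableSet {ω | H ω = h})
    {G : Ω → ℝ} (hG : ∀ ω ω', H ω = H ω' → G ω = G ω') : Integrable G Pr := by
  have hfin : (Set.range fun ω => ‖G ω‖).Finite := by
    have hsub : (Set.range fun ω => ‖G ω‖) ⊆ Set.range fun h => ‖Function.extend H G 0 h‖ := by
      rintro _ ⟨ω, rfl⟩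
      refine ⟨H ω, ?_⟩
      simp only
      rw [Function.FactorsThrough.extend_apply (fun a b h => hG a b h)]
    exact (Set.finite_range _).subset hsub
  obtain ⟨C, hC⟩ := hfin.bddAbove
  exact Integrable.of_bound (measurable_of_factorsThrough hH hG).aestronglyMeasurable C
    (Eventually.of_forall fun ω => hC ⟨ω, rfl⟩)

theorem integral_comp_eq_sum [IsFiniteMeasure Pr] (hH : ∀ h, MeasurableSet {ω | H ω = h})
    (g : ι → ℝ) : ∫ ω, g (H ω) ∂Pr = ∑ h, Pr.real {ω | H ω = h} * g h := by
  classical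
  have e : ∀ ω, g (H ω) = ∑ h, Set.indicator {ω | H ω = h} (fun _ => g h) ω := by
    intro ω
    rw [Finset.sum_eq_single (H ω)]
    · simp
    · intro h _ hne
      exact Set.indicator_of_notMem (fun h' => hne h'.symm) _
    · simp
  simp_rw [e]
  rw [integral_finsetSum _ fun h _ => (integrable_const _).indicator (hH h)]
  refine Finset.sum_congr rfl fun h _ => ?_
  rw [integral_indicator_const _ (hH h), smul_eq_mul]

end FiniteRange

/-! ### Markov property of the trajectory and moments of the follow-on trace. -/

section Markov

variable {S : Type u} {A : Type v} [Fintype S] [Fintype A] [DecidableEq S]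
  {M : MDP S A} {μ : Policy S A}

namespace Trajectory

variable (X : Trajectory.{u, v, w} M μ)

theorem measurableSet_state (t : ℕ) (x : S) : MeasurableSet {ω | X.s t ω = x} := by
  have : {ω | X.s t ω = x} = ⋃ u, {ω | X.s t ω = x ∧ X.a t ω = u} := by ext; simp
  rw [this]
  exact MeasurableSet.iUnion fun u => X.measurableSet_fiber t x u

theorem measurableSet_action (t : ℕ) (u : A) : MeasurableSet {ω | X.a t ω = u} := by
  have : {ω | X.a t ω = u} = ⋃ x, {ω | X.s t ω = x ∧ X.a t ω = u} := by ext; simp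
  rw [this]
  exact MeasurableSet.iUnion fun x => X.measurableSet_fiber t x u

/-- The states up to time `n` and the actions before time `n`. -/
def hist (n : ℕ) (ω : X.Ω) : (Fin (n + 1) → S) × (Fin n → A) :=
  (fun k => X.s k ω, fun k => X.a k ω)

theorem hist_eq_iff {n : ℕ} {ω ω' : X.Ω} : X.hist n ω = X.hist n ω' ↔
    (∀ k ≤ n, X.s k ω = X.s k ω') ∧ ∀ k < n, X.a k ω = X.a k ω' := by
  simp only [hist, Prod.mk.injEq, funext_iff, Fin.forall_iff, Nat.lt_succ_iff]

theorem measurableSet_hist (n : ℕ) (h : (Fin (n + 1) → S) × (Fin n → A)) :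
    MeasurableSet {ω | X.hist n ω = h} := by
  have : {ω | X.hist n ω = h} =
      (⋂ k : Fin (n + 1), {ω | X.s k ω = h.1 k}) ∩ ⋂ k : Fin n, {ω | X.a k ω = h.2 k} := by
    ext ω
    simp [hist, Prod.ext_iff, funext_iff]
  rw [this]
  exact (MeasurableSet.iInter fun k => X.measurableSet_state _ _).inter
    (MeasurableSet.iInter fun k => X.measurableSet_action _ _)

/-- `G` is a function of the states up to time `n` and the actions before time `n`. -/
def Adapted {β : Type*} (n : ℕ) (G : X.Ω → β) : Prop :=
  ∀ ω ω', X.hist n ω = X.hist n ω' → G ω = G ω'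

variable {X}

theorem Adapted.mono {β : Type*} {m n : ℕ} {G : X.Ω → β} (h : X.Adapted m G) (hmn : m ≤ n) :
    X.Adapted n G := fun ω ω' hω => h ω ω' <| by
  rw [hist_eq_iff] at hω ⊢
  exact ⟨fun k hk => hω.1 k (hk.trans hmn), fun k hk => hω.2 k (hk.trans_le hmn)⟩

theorem Adapted.comp {β β' : Type*} {n : ℕ} {G : X.Ω → β} (h : X.Adapted n G) (g : β → β') :
    X.Adapted n fun ω => g (G ω) := fun ω ω' hω => congrArg g (h ω ω' hω)

theorem Adapted.comp₂ {β β' β'' : Type*} {n : ℕ} {G : X.Ω → β} {G' : X.Ω → β'}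
    (h : X.Adapted n G) (h' : X.Adapted n G') (g : β → β' → β'') :
    X.Adapted n fun ω => g (G ω) (G' ω) := fun ω ω' hω => congrArg₂ g (h ω ω' hω) (h' ω ω' hω)

theorem Adapted.mul {n : ℕ} {G G' : X.Ω → ℝ} (h : X.Adapted n G) (h' : X.Adapted n G') :
    X.Adapted n fun ω => G ω * G' ω := h.comp₂ h' (· * ·)

theorem Adapted.add {n : ℕ} {G G' : X.Ω → ℝ} (h : X.Adapted n G) (h' : X.Adapted n G') :
    X.Adapted n fun ω => G ω + G' ω := h.comp₂ h' (· + ·)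

theorem adapted_const {β : Type*} (n : ℕ) (c : β) : X.Adapted n fun _ => c := fun _ _ _ => rfl

theorem adapted_state (n : ℕ) : X.Adapted n (X.s n) := fun _ _ h =>
  (X.hist_eq_iff.1 h).1 n le_rfl

theorem adapted_action {m n : ℕ} (hmn : m < n) : X.Adapted n (X.a m) := fun _ _ h =>
  (X.hist_eq_iff.1 h).2 m hmn

theorem Adapted.integrable {n : ℕ} {G : X.Ω → ℝ} (h : X.Adapted n G) : Integrable G X.Pr :=
  integrable_of_factorsThrough (X.measurableSet_hist n) h

variable (X)

/-- Marginalize the given law over the action at time `n`. Histories stop before that action so that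
it can still be averaged out in the Markov property. -/
theorem real_hist_eq (n : ℕ) (x : ℕ → S) (u : ℕ → A) :
    X.Pr.real {ω | (∀ k ≤ n, X.s k ω = x k) ∧ ∀ k < n, X.a k ω = u k} =
      X.Pr.real {ω | X.s 0 ω = x 0} *
        ∏ k ∈ Finset.range n, μ.prob (x k) (u k) * M.P (x k) (u k) (x (k + 1)) := by
  classical
  have hset : {ω | (∀ k ≤ n, X.s k ω = x k) ∧ ∀ k < n, X.a k ω = u k} =
      ⋃ a : A, {ω | ∀ k ≤ n, X.s k ω = x k ∧ X.a k ω = Function.update u n a k} := by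
    ext ω
    simp only [Set.mem_ofPred_eq, Set.mem_iUnion]
    constructor
    · rintro ⟨h1, h2⟩
      refine ⟨X.a n ω, fun k hk => ⟨h1 k hk, ?_⟩⟩
      rcases hk.eq_or_lt with rfl | hlt
      · simp
      · rw [Function.update_of_ne hlt.ne, h2 k hlt]
    · rintro ⟨a, h⟩
      refine ⟨fun k hk => (h k hk).1, fun k hk => ?_⟩
      rw [(h k hk.le).2, Function.update_of_ne hk.ne]
  rw [hset, measureReal_iUnion_fintype]
  · simp_rw [X.law]
    rw [← Finset.sum_congr rfl fun a _ => ?_, ← Finset.mul_sum _ _ (X.Pr.real {ω | X.s 0 ω = x 0} *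
        ∏ k ∈ Finset.range n, μ.prob (x k) (u k) * M.P (x k) (u k) (x (k + 1))),
      μ.sum_eq_one (x n), mul_one]
    rw [Function.update_self]
    congr 2
    refine Finset.prod_congr rfl fun k hk => ?_
    rw [Function.update_of_ne (Finset.mem_range.1 hk).ne]
  · intro a a' hne
    refine Set.disjoint_left.2 fun ω h1 h2 => hne ?_
    have e1 := (h1 n le_rfl).2
    have e2 := (h2 n le_rfl).2
    rw [Function.update_self] at e1 e2
    exact e1.symm.trans e2
  · intro a
    have : {ω | ∀ k ≤ n, X.s k ω = x k ∧ X.a k ω = Function.update u n a k} =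
        ⋂ k, ⋂ (_ : k ≤ n), {ω | X.s k ω = x k ∧ X.a k ω = Function.update u n a k} := by
      ext; simp
    rw [this]
    exact MeasurableSet.iInter fun k => MeasurableSet.iInter fun _ => X.measurableSet_fiber _ _ _

theorem real_hist_step (n : ℕ) (h : (Fin (n + 1) → S) × (Fin n → A)) (a : A) (y : S) :
    X.Pr.real {ω | (X.hist n ω, X.a n ω, X.s (n + 1) ω) = (h, a, y)} =
      X.Pr.real {ω | X.hist n ω = h} * (μ.prob (h.1 (Fin.last n)) a * M.P (h.1 (Fin.last n)) a y) := by
  classical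
  -- A realized history supplies infinite sequences to feed into the law; for an unrealized one both
  -- events are empty.
  by_cases hex : ∃ ω₀, X.hist n ω₀ = h
  · obtain ⟨ω₀, rfl⟩ := hex
    have e1 : {ω | X.hist n ω = X.hist n ω₀} = {ω | (∀ k ≤ n, X.s k ω = (fun k => X.s k ω₀) k) ∧
        ∀ k < n, X.a k ω = (fun k => X.a k ω₀) k} := by
      ext ω; exact X.hist_eq_iff
    have e2 : {ω | (X.hist n ω, X.a n ω, X.s (n + 1) ω) = (X.hist n ω₀, a, y)} =
        {ω | (∀ k ≤ n + 1, X.s k ω = Function.update (fun k => X.s k ω₀) (n + 1) y k) ∧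
        ∀ k < n + 1, X.a k ω = Function.update (fun k => X.a k ω₀) n a k} := by
      ext ω
      simp only [Set.mem_ofPred_eq, Prod.mk.injEq, X.hist_eq_iff]
      constructor
      · rintro ⟨⟨h1, h2⟩, h3, h4⟩
        refine ⟨fun k hk => ?_, fun k hk => ?_⟩
        · rcases hk.eq_or_lt with rfl | hlt
          · simpa using h4
          · rw [Function.update_of_ne hlt.ne, h1 k (by omega)]
        · rcases (Nat.lt_succ_iff.1 hk).eq_or_lt with rfl | hlt
          · simpa using h3
          · rw [Function.update_of_ne hlt.ne, h2 k hlt]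
      · rintro ⟨h1, h2⟩
        refine ⟨⟨fun k hk => ?_, fun k hk => ?_⟩, ?_, ?_⟩
        · rw [h1 k (by omega), Function.update_of_ne (by omega)]
        · rw [h2 k (by omega), Function.update_of_ne (by omega)]
        · rw [h2 n (by omega), Function.update_self]
        · rw [h1 (n + 1) le_rfl, Function.update_self]
    rw [e1, e2, X.real_hist_eq, X.real_hist_eq, Finset.prod_range_succ,
      Function.update_of_ne (by omega), Function.update_self, Function.update_self,
      Function.update_of_ne (by omega), ← mul_assoc]
    congr 2
    refine Finset.prod_congr rfl fun k hk => ?_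
    have hk := Finset.mem_range.1 hk
    rw [Function.update_of_ne (by omega), Function.update_of_ne (by omega),
      Function.update_of_ne (by omega)]
  · have e1 : {ω | X.hist n ω = h} = ∅ := by
      ext ω; simpa using fun hω => hex ⟨ω, hω⟩
    have e2 : {ω | (X.hist n ω, X.a n ω, X.s (n + 1) ω) = (h, a, y)} = ∅ := by
      ext ω; simpa using fun hω => absurd ⟨ω, hω⟩ hex
    rw [e1, e2]
    simp

/-- The one-step Markov property. -/
theorem integral_step_of_adapted {n : ℕ} {Ψ : X.Ω → S → A → S → ℝ} (hΨ : X.Adapted n Ψ) :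
    ∫ ω, Ψ ω (X.s n ω) (X.a n ω) (X.s (n + 1) ω) ∂X.Pr =
      ∫ ω, ∑ a, μ.prob (X.s n ω) a * ∑ y, M.P (X.s n ω) a y * Ψ ω (X.s n ω) a y ∂X.Pr := by
  -- Write `Ψ` as a function of the history, so that both integrals become finite sums. The value
  -- zero is used only at unrealized histories.
  set g := Function.extend (X.hist n) Ψ 0 with hg
  have hGg : ∀ ω, Ψ ω = g (X.hist n ω) := fun ω =>
    (Function.FactorsThrough.extend_apply (fun a b h => hΨ a b h) _ _).symm
  have hmeas : ∀ p : ((Fin (n + 1) → S) × (Fin n → A)) × A × S,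
      MeasurableSet {ω | (X.hist n ω, X.a n ω, X.s (n + 1) ω) = p} := by
    rintro ⟨h, a, y⟩
    have : {ω | (X.hist n ω, X.a n ω, X.s (n + 1) ω) = (h, a, y)} =
        {ω | X.hist n ω = h} ∩ ({ω | X.a n ω = a} ∩ {ω | X.s (n + 1) ω = y}) := by
      ext; simp
    rw [this]
    exact (X.measurableSet_hist n h).inter
      ((X.measurableSet_action n a).inter (X.measurableSet_state (n + 1) y))
  have h1 := integral_comp_eq_sum (Pr := X.Pr) hmeas
    fun p => g p.1 (p.1.1 (Fin.last n)) p.2.1 p.2.2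
  have h2 := integral_comp_eq_sum (Pr := X.Pr) (X.measurableSet_hist n)
    fun h => ∑ a, μ.prob (h.1 (Fin.last n)) a *
      ∑ y, M.P (h.1 (Fin.last n)) a y * g h (h.1 (Fin.last n)) a y
  have e : ∀ ω, (X.hist n ω).1 (Fin.last n) = X.s n ω := fun ω => rfl
  simp only [← hGg, e] at h1 h2
  rw [h1, h2, Fintype.sum_prod_type]
  refine Finset.sum_congr rfl fun h _ => ?_
  rw [Fintype.sum_prod_type, Finset.mul_sum]
  refine Finset.sum_congr rfl fun a _ => ?_
  rw [Finset.mul_sum, Finset.mul_sum]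
  refine Finset.sum_congr rfl fun y _ => ?_
  rw [X.real_hist_step]
  ring

theorem integral_step {n : ℕ} {G : X.Ω → ℝ} (hG : X.Adapted n G) (ψ : S → A → S → ℝ) :
    ∫ ω, G ω * ψ (X.s n ω) (X.a n ω) (X.s (n + 1) ω) ∂X.Pr =
      ∫ ω, G ω * ∑ a, μ.prob (X.s n ω) a * ∑ y, M.P (X.s n ω) a y * ψ (X.s n ω) a y ∂X.Pr := by
  rw [X.integral_step_of_adapted (hG.comp fun g s a y => g * ψ s a y)]
  simp only [Finset.mul_sum]
  refine integral_congr_ae (Eventually.of_forall fun ω => ?_)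
  exact Finset.sum_congr rfl fun a _ => Finset.sum_congr rfl fun y _ => by ring

/-- The follow-on trace restarted at time `n`, after `τ` steps. -/
noncomputable def trace (π : Policy S A) (n τ : ℕ) (ω : X.Ω) : ℝ :=
  followOn M.γ (fun k => ratio π μ (X.s (n + k) ω) (X.a (n + k) ω)) τ

theorem trace_zero (π : Policy S A) (n : ℕ) (ω : X.Ω) : X.trace π n 0 ω = 1 := rfl

theorem trace_succ (π : Policy S A) (n τ : ℕ) (ω : X.Ω) : X.trace π n (τ + 1) ω =
    M.γ * ratio π μ (X.s (n + τ) ω) (X.a (n + τ) ω) * X.trace π n τ ω + 1 := rfl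

variable {X} in
theorem adapted_trace (π : Policy S A) (n τ : ℕ) : X.Adapted (n + τ) (X.trace π n τ) := by
  induction τ with
  | zero => exact adapted_const _ _
  | succ τ ih =>
    have h1 : X.Adapted (n + (τ + 1)) (X.s (n + τ)) := (adapted_state _).mono (by omega)
    have h2 : X.Adapted (n + (τ + 1)) (X.a (n + τ)) := adapted_action (by omega)
    have h3 := (((h1.comp₂ h2 fun s a => M.γ * ratio π μ s a).mul
      (ih.mono (by omega : n + τ ≤ n + (τ + 1)))).add (adapted_const _ 1))
    exact h3

theorem integral_state {n : ℕ} {G : X.Ω → ℝ} (hG : X.Adapted n G) (m : ℕ) (h : S → ℝ) :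
    ∫ ω, G ω * h (X.s (n + m) ω) ∂X.Pr =
      ∫ ω, G ω * ((transMatrix M μ ^ m) *ᵥ h) (X.s n ω) ∂X.Pr := by
  induction m generalizing h with
  | zero => simp
  | succ m ih =>
    have := X.integral_step (hG.mono (Nat.le_add_right n m)) fun _ _ y => h y
    rw [← add_assoc, this, pow_succ, ← mulVec_mulVec, ← ih]
    refine integral_congr_ae (Eventually.of_forall fun ω => ?_)
    simp only [mulVec, dotProduct, transMatrix, of_apply, Finset.sum_mul, Finset.mul_sum]
    rw [Finset.sum_comm]
    simp only [mul_assoc]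

variable {π : Policy S A}

theorem _root_.PerETD.Coverage.mul_ratio (hcov : Coverage π μ) (s : S) (a : A) :
    μ.prob s a * ratio π μ s a = π.prob s a := by
  rcases (μ.nonneg s a).eq_or_lt with h | h
  · have : ¬ 0 < π.prob s a := fun h' => (hcov s a h').ne h
    rw [← h, zero_mul]
    exact le_antisymm (π.nonneg s a) (not_lt.1 this)
  · exact mul_div_cancel₀ _ h.ne'

/-- Split `F_{b+1} = γ ρ F_b + 1`. The weight `ρ` turns the last `μ`-step into a `π`-step, giving `γ
U_b P_π`, while the constant one gives `P_μ^{b+1}`. -/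
theorem integral_trace (hcov : Coverage π μ) {n : ℕ} {G : X.Ω → ℝ} (hG : X.Adapted n G) (b : ℕ)
    (h : S → ℝ) :
    ∫ ω, G ω * X.trace π n b ω * h (X.s (n + b) ω) ∂X.Pr =
      ∫ ω, G ω * (traceKernel M.γ (transMatrix M π) (transMatrix M μ) b *ᵥ h) (X.s n ω) ∂X.Pr := by
  induction b generalizing h with
  | zero => simp [trace_zero, traceKernel]
  | succ b ih =>
    have hGF : X.Adapted (n + b) fun ω => G ω * X.trace π n b ω :=
      (hG.mono (Nat.le_add_right n b)).mul (adapted_trace π n b)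
    have hs : X.Adapted (n + (b + 1)) fun ω => h (X.s (n + (b + 1)) ω) := (adapted_state _).comp h
    have h1 : X.Adapted (n + (b + 1)) (X.s (n + b)) := (adapted_state _).mono (by omega)
    have h2 : X.Adapted (n + (b + 1)) (X.a (n + b)) := adapted_action (by omega)
    have hρ := h1.comp₂ h2 (ratio π μ)
    have i1 : Integrable (fun ω => M.γ * (G ω * X.trace π n b ω *
        (ratio π μ (X.s (n + b) ω) (X.a (n + b) ω) * h (X.s (n + b + 1) ω)))) X.Pr :=
      ((hGF.mono (by omega)).mul (hρ.mul hs)).integrable.const_mul _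
    have i2 : Integrable (fun ω => G ω * h (X.s (n + (b + 1)) ω)) X.Pr :=
      ((hG.mono (by omega)).mul hs).integrable
    have e1 : ∫ ω, G ω * X.trace π n b ω *
        (ratio π μ (X.s (n + b) ω) (X.a (n + b) ω) * h (X.s (n + b + 1) ω)) ∂X.Pr =
        ∫ ω, G ω * (traceKernel M.γ (transMatrix M π) (transMatrix M μ) b *ᵥ
          (transMatrix M π *ᵥ h)) (X.s n ω) ∂X.Pr := by
      rw [← ih, X.integral_step hGF fun s a y => ratio π μ s a * h y]
      refine integral_congr_ae (Eventually.of_forall fun ω => ?_)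
      simp only [mulVec, dotProduct, transMatrix, of_apply, Finset.sum_mul, Finset.mul_sum]
      rw [Finset.sum_comm]
      refine Finset.sum_congr rfl fun y _ => Finset.sum_congr rfl fun a _ => ?_
      rw [← hcov.mul_ratio]
      ring
    have j1 : Integrable (fun ω => G ω * (traceKernel M.γ (transMatrix M π) (transMatrix M μ) b *ᵥ
          (transMatrix M π *ᵥ h)) (X.s n ω)) X.Pr :=
      (hG.mul ((adapted_state n).comp _)).integrable
    have j2 : Integrable (fun ω => G ω * ((transMatrix M μ ^ (b + 1)) *ᵥ h) (X.s n ω)) X.Pr :=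
      (hG.mul ((adapted_state n).comp _)).integrable
    calc ∫ ω, G ω * X.trace π n (b + 1) ω * h (X.s (n + (b + 1)) ω) ∂X.Pr
        = ∫ ω, (M.γ * (G ω * X.trace π n b ω *
            (ratio π μ (X.s (n + b) ω) (X.a (n + b) ω) * h (X.s (n + b + 1) ω))) +
            G ω * h (X.s (n + (b + 1)) ω)) ∂X.Pr := by
          refine integral_congr_ae (Eventually.of_forall fun ω => ?_)
          simp only [trace_succ, ← add_assoc]
          ring
      _ = ∫ ω, (M.γ * (G ω * (traceKernel M.γ (transMatrix M π) (transMatrix M μ) b *ᵥ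
            (transMatrix M π *ᵥ h)) (X.s n ω)) +
            G ω * ((transMatrix M μ ^ (b + 1)) *ᵥ h) (X.s n ω)) ∂X.Pr := by
          rw [integral_add i1 i2, integral_add (j1.const_mul _) j2, integral_const_mul,
            integral_const_mul, e1, X.integral_state hG]
      _ = _ := by
          refine integral_congr_ae (Eventually.of_forall fun ω => ?_)
          simp only [traceKernel, add_mulVec, smul_mulVec, mulVec_mulVec, Pi.add_apply,
            Pi.smul_apply, smul_eq_mul]
          ring

/-- The trace kernel governs expectations of functions of the past and the current state. -/
theorem integral_trace_mul (hcov : Coverage π μ) {n : ℕ} {H : S → X.Ω → ℝ}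
    (hH : ∀ j, X.Adapted n (H j)) (b : ℕ) :
    ∫ ω, X.trace π n b ω * H (X.s (n + b) ω) ω ∂X.Pr =
      ∫ ω, ∑ j, traceKernel M.γ (transMatrix M π) (transMatrix M μ) b (X.s n ω) j * H j ω ∂X.Pr := by
  -- Decomposing over the value of the final state leaves, in each summand, a factor known at time
  -- `n`.
  have e1 : ∀ ω, X.trace π n b ω * H (X.s (n + b) ω) ω =
      ∑ j, H j ω * X.trace π n b ω * (Pi.single j 1 : S → ℝ) (X.s (n + b) ω) := by
    intro ω
    rw [Finset.sum_eq_single (X.s (n + b) ω)]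
    · simp [mul_comm]
    · intro j _ hj
      rw [Pi.single_eq_of_ne hj.symm, mul_zero]
    · simp
  simp_rw [e1]
  rw [integral_finsetSum, integral_finsetSum]
  · refine Finset.sum_congr rfl fun j _ => ?_
    rw [X.integral_trace hcov (hH j)]
    refine integral_congr_ae (Eventually.of_forall fun ω => ?_)
    simp [mul_comm]
  · exact fun j _ => (((adapted_state n).comp fun s =>
      traceKernel M.γ (transMatrix M π) (transMatrix M μ) b s j).mul (hH j)).integrable
  · exact fun j _ => ((((hH j).mono (Nat.le_add_right n b)).mul (adapted_trace π n b)).mul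
      ((adapted_state (n + b)).comp _)).integrable

theorem ratio_nonneg (s : S) (a : A) : 0 ≤ ratio π μ s a :=
  div_nonneg (π.nonneg s a) (μ.nonneg s a)

theorem ratio_le_rhoMax (s : S) (a : A) : ratio π μ s a ≤ rhoMax π μ :=
  le_ciSup (f := fun p : S × A => ratio π μ p.1 p.2) (Set.finite_range _).bddAbove (s, a)

theorem rhoMax_nonneg : 0 ≤ rhoMax π μ := Real.iSup_nonneg fun _ => ratio_nonneg _ _

theorem integral_mul_ratio (hcov : Coverage π μ) {n : ℕ} {G : X.Ω → ℝ} (hG : X.Adapted n G) :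
    ∫ ω, G ω * ratio π μ (X.s n ω) (X.a n ω) ∂X.Pr = ∫ ω, G ω ∂X.Pr := by
  rw [X.integral_step hG fun s a _ => ratio π μ s a]
  refine integral_congr_ae (Eventually.of_forall fun ω => ?_)
  simp only [← Finset.sum_mul, M.P_sum, one_mul, hcov.mul_ratio, π.sum_eq_one, mul_one]

/-- Because `μ ρ² = π ρ`, the squared ratio costs one factor `ρ_max` instead of two. Hence the
threshold is at `γ² ρ_max = 1`. -/
theorem integral_mul_ratio_sq_le (hcov : Coverage π μ) {n : ℕ} {G : X.Ω → ℝ} (hG : X.Adapted n G)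
    (h0 : ∀ ω, 0 ≤ G ω) :
    ∫ ω, G ω * ratio π μ (X.s n ω) (X.a n ω) ^ 2 ∂X.Pr ≤ rhoMax π μ * ∫ ω, G ω ∂X.Pr := by
  rw [X.integral_step hG fun s a _ => ratio π μ s a ^ 2, ← integral_const_mul]
  refine integral_mono (hG.mul ((adapted_state n).comp fun s =>
    ∑ a, μ.prob s a * ∑ y, M.P s a y * ratio π μ s a ^ 2)).integrable
    (hG.integrable.const_mul _) fun ω => ?_
  simp only
  rw [mul_comm]
  refine mul_le_mul_of_nonneg_right ?_ (h0 ω)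
  calc ∑ a, μ.prob (X.s n ω) a * ∑ y, M.P (X.s n ω) a y * ratio π μ (X.s n ω) a ^ 2
      = ∑ a, ratio π μ (X.s n ω) a * π.prob (X.s n ω) a := by
        refine Finset.sum_congr rfl fun a _ => ?_
        rw [← Finset.sum_mul, M.P_sum, one_mul, ← hcov.mul_ratio]
        ring
    _ ≤ ∑ a, rhoMax π μ * π.prob (X.s n ω) a := Finset.sum_le_sum fun a _ =>
        mul_le_mul_of_nonneg_right (ratio_le_rhoMax _ _) (π.nonneg _ _)
    _ = rhoMax π μ := by rw [← Finset.mul_sum, π.sum_eq_one, mul_one]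

theorem integral_trace_le (hcov : Coverage π μ) (n τ : ℕ) :
    ∫ ω, X.trace π n τ ω ∂X.Pr ≤ 1 / (1 - M.γ) := by
  have hγ : 0 < 1 - M.γ := by linarith [M.γ_lt_one]
  have hγ0 := M.γ_pos
  induction τ with
  | zero =>
    simp only [trace_zero, integral_const, probReal_univ, one_smul]
    rw [le_div_iff₀ hγ]
    linarith
  | succ τ ih =>
    have hF : X.Adapted (n + τ) (X.trace π n τ) := adapted_trace π n τ
    have hFρ : X.Adapted (n + τ + 1) fun ω =>
        X.trace π n τ ω * ratio π μ (X.s (n + τ) ω) (X.a (n + τ) ω) :=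
      (hF.mono (by omega)).mul (((adapted_state _).mono (by omega)).comp₂
        (adapted_action (by omega)) (ratio π μ))
    have e : ∫ ω, X.trace π n (τ + 1) ω ∂X.Pr = M.γ * ∫ ω, X.trace π n τ ω ∂X.Pr + 1 := by
      rw [← X.integral_mul_ratio hcov hF, ← integral_const_mul]
      have : ∀ ω, X.trace π n (τ + 1) ω = M.γ * (X.trace π n τ ω *
          ratio π μ (X.s (n + τ) ω) (X.a (n + τ) ω)) + 1 := fun ω => by rw [trace_succ]; ring
      simp_rw [this]
      rw [integral_add (hFρ.integrable.const_mul _) (integrable_const _)]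
      simp
    rw [e]
    rw [le_div_iff₀ hγ] at ih ⊢
    nlinarith

/-- The recursive bound for the second moment of the follow-on trace. -/
noncomputable def _root_.PerETD.secondMomentBound (q c : ℝ) : ℕ → ℝ
  | 0 => 1
  | b + 1 => q * secondMomentBound q c b + c

/-- Expand `(γ ρ F + 1)²`. The cross term is controlled by the first moment, which stays below `1/(1
- γ)`, so only the square term can grow. -/
theorem integral_trace_sq_le (hcov : Coverage π μ) (n τ : ℕ) :
    ∫ ω, X.trace π n τ ω ^ 2 ∂X.Pr ≤
      secondMomentBound (M.γ ^ 2 * rhoMax π μ) (2 * M.γ / (1 - M.γ) + 1) τ := by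
  have hγ0 := M.γ_pos
  induction τ with
  | zero => simp [trace_zero, secondMomentBound]
  | succ τ ih =>
    have hF : X.Adapted (n + τ) (X.trace π n τ) := adapted_trace π n τ
    have hF2 : X.Adapted (n + τ) fun ω => X.trace π n τ ω ^ 2 := hF.comp (· ^ 2)
    have hρ : X.Adapted (n + τ + 1) fun ω => ratio π μ (X.s (n + τ) ω) (X.a (n + τ) ω) :=
      ((adapted_state _).mono (by omega)).comp₂ (adapted_action (by omega)) (ratio π μ)
    have hFρ : X.Adapted (n + τ + 1) fun ω =>
        X.trace π n τ ω * ratio π μ (X.s (n + τ) ω) (X.a (n + τ) ω) := (hF.mono (by omega)).mul hρ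
    have hF2ρ : X.Adapted (n + τ + 1) fun ω =>
        X.trace π n τ ω ^ 2 * ratio π μ (X.s (n + τ) ω) (X.a (n + τ) ω) ^ 2 :=
      (hF2.mono (by omega)).mul (hρ.comp (· ^ 2))
    have e : ∀ ω, X.trace π n (τ + 1) ω ^ 2 = M.γ ^ 2 * (X.trace π n τ ω ^ 2 *
        ratio π μ (X.s (n + τ) ω) (X.a (n + τ) ω) ^ 2) + (2 * M.γ * (X.trace π n τ ω *
        ratio π μ (X.s (n + τ) ω) (X.a (n + τ) ω)) + 1) := fun ω => by rw [trace_succ]; ring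
    simp_rw [e]
    have i1 := hF2ρ.integrable.const_mul (M.γ ^ 2)
    have i2 := hFρ.integrable.const_mul (2 * M.γ)
    have i3 : Integrable (fun ω => 2 * M.γ * (X.trace π n τ ω *
        ratio π μ (X.s (n + τ) ω) (X.a (n + τ) ω)) + 1) X.Pr := i2.add (integrable_const 1)
    rw [integral_add i1 i3, integral_add i2 (integrable_const 1),
      integral_const_mul, integral_const_mul, X.integral_mul_ratio hcov hF]
    simp only [integral_const, probReal_univ, one_smul, secondMomentBound]
    have h1 := X.integral_mul_ratio_sq_le hcov hF2 fun ω => sq_nonneg _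
    have h2 := X.integral_trace_le (π := π) hcov n τ
    have h3 : M.γ ^ 2 * ∫ ω, X.trace π n τ ω ^ 2 *
        ratio π μ (X.s (n + τ) ω) (X.a (n + τ) ω) ^ 2 ∂X.Pr ≤ M.γ ^ 2 * rhoMax π μ *
        secondMomentBound (M.γ ^ 2 * rhoMax π μ) (2 * M.γ / (1 - M.γ) + 1) τ := by
      rw [mul_assoc]
      exact mul_le_mul_of_nonneg_left
        (h1.trans (mul_le_mul_of_nonneg_left ih rhoMax_nonneg)) (sq_nonneg _)
    have h4 := mul_le_mul_of_nonneg_left h2 (by positivity : 0 ≤ 2 * M.γ)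
    rw [mul_one_div] at h4
    linarith

/-- The limit of `d_μ(i) E[F_t | s_t = i]`. -/
theorem tendsto_condTrace (hcov : Coverage π μ) {d f : S → ℝ}
    (hf : IsEmphasis M.γ (transMatrix M π) d f) {C χ : ℝ}
    (hG : IsGeometricRate (transMatrix M μ) d C χ) (hne : χ ≠ M.γ) {i : S} (hd : 0 < d i) :
    Tendsto (fun t => d i * X.condTrace π t i) atTop (𝓝 (f i)) := by
  set U := traceKernel M.γ (transMatrix M π) (transMatrix M μ) with hU
  -- Row convergence uniform in the starting state survives averaging over any initial law. It is
  -- used for the numerator `E[F_t; s_t = i]` and for the denominator `P(s_t = i)`.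
  have hsmall : ∀ (W : ℕ → Matrix S S ℝ) (g : S → ℝ) (K ξ : ℝ), 0 ≤ ξ → ξ < 1 →
      (∀ t s, ∑ j, |W t s j - g j| ≤ K * ξ ^ t) →
      Tendsto (fun t => ∫ ω, W t (X.s 0 ω) i ∂X.Pr) atTop (𝓝 (g i)) := by
    intro W g K ξ hξ0 hξ1 hW
    rw [tendsto_iff_norm_sub_tendsto_zero]
    have hlim : Tendsto (fun t : ℕ => K * ξ ^ t) atTop (𝓝 0) := by
      simpa using (tendsto_pow_atTop_nhds_zero_of_lt_one hξ0 hξ1).const_mul K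
    refine squeeze_zero (fun _ => norm_nonneg _) (fun t => ?_) hlim
    have hint : Integrable (fun ω => W t (X.s 0 ω) i) X.Pr :=
      ((adapted_state 0).comp fun s => W t s i).integrable
    have e : ∫ ω, W t (X.s 0 ω) i ∂X.Pr - g i = ∫ ω, (W t (X.s 0 ω) i - g i) ∂X.Pr := by
      rw [integral_sub hint (integrable_const _)]
      simp
    rw [e]
    have := norm_integral_le_of_norm_le_const (μ := X.Pr) (f := fun ω => W t (X.s 0 ω) i - g i)
      (C := K * ξ ^ t) (Eventually.of_forall fun ω =>
        (Finset.single_le_sum (f := fun j => |W t (X.s 0 ω) j - g j|) (fun _ _ => abs_nonneg _)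
          (Finset.mem_univ i)).trans (hW t _))
    simpa using this
  have h1 := hsmall U f _ _ (M.γ_pos.le.trans (le_max_left _ _)) (max_lt M.γ_lt_one hG.χ_lt_one)
    (sum_abs_traceKernel_sub_le M.γ_pos (transMatrix_mem_rowStochastic M π) hf hG hne)
  have h2 := hsmall (fun t => transMatrix M μ ^ t) d _ _ hG.χ_pos.le hG.χ_lt_one
    fun t s => hG.bound s t
  have e : ∀ t, X.condTrace π t i = (∫ ω, (transMatrix M μ ^ t) (X.s 0 ω) i ∂X.Pr)⁻¹ *
      ∫ ω, U t (X.s 0 ω) i ∂X.Pr := by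
    intro t
    have hm := X.measurableSet_state t i
    have hind : ∀ G : X.Ω → ℝ, ∫ ω in {ω | X.s t ω = i}, G ω ∂X.Pr =
        ∫ ω, G ω * (Pi.single i 1 : S → ℝ) (X.s t ω) ∂X.Pr := by
      intro G
      rw [← integral_indicator hm]
      refine integral_congr_ae (Eventually.of_forall fun ω => ?_)
      by_cases h : X.s t ω = i
      · simp [Set.indicator, h]
      · simp [Set.indicator, h]
    have e1 := X.integral_trace hcov (n := 0) (adapted_const 0 1) t (Pi.single i 1)
    have e2 := X.integral_state (n := 0) (adapted_const 0 1) t (Pi.single i 1)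
    simp only [one_mul, zero_add, mulVec_single_one, col_apply] at e1 e2
    rw [condTrace, ProbabilityTheory.cond, integral_smul_measure, smul_eq_mul, hind,
      ENNReal.toReal_inv]
    congr 1
    · rw [← e2]
      congr 1
      have := hind fun _ => 1
      simp only [one_mul] at this
      rw [← this]
      simp [Measure.real]
    · refine Eq.trans (integral_congr_ae (Eventually.of_forall fun ω => ?_)) e1
      simp [trace]
  simp_rw [e]
  have := ((h2.inv₀ hd.ne').mul h1).const_mul (d i)
  rwa [mul_inv_cancel_left₀ hd.ne'] at this

end Trajectory

end Markov

/-! ### Projection onto the ball, and a scalar recursion. -/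

section Projection

variable {d : ℕ} {B : ℝ}

theorem norm_projBall_le (hB : 0 ≤ B) (x : EuclideanSpace ℝ (Fin d)) : ‖projBall B x‖ ≤ B := by
  unfold projBall
  split_ifs with h
  · exact h
  · have hx : 0 < ‖x‖ := hB.trans_lt (not_le.1 h)
    rw [norm_smul, Real.norm_eq_abs, abs_of_nonneg (by positivity), div_mul_cancel₀ _ hx.ne']

/-- Outside the ball, with `c = B/‖x‖`, Cauchy–Schwarz gives `⟨x, z⟩ ≤ c ‖x‖²`, so projecting lowers
the squared distance by at least `(1 - c)² ‖x‖²`. -/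
theorem norm_projBall_sub_sq_le {z : EuclideanSpace ℝ (Fin d)} (hz : ‖z‖ ≤ B)
    (x : EuclideanSpace ℝ (Fin d)) : ‖projBall B x - z‖ ^ 2 ≤ ‖x - z‖ ^ 2 := by
  have hB : 0 ≤ B := (norm_nonneg z).trans hz
  unfold projBall
  split_ifs with h
  · exact le_rfl
  · have hlt : B < ‖x‖ := not_le.1 h
    have hx : 0 < ‖x‖ := hB.trans_lt hlt
    set c := B / ‖x‖ with hc
    have hcx : c * ‖x‖ = B := div_mul_cancel₀ _ hx.ne'
    have hc0 : 0 ≤ c := by positivity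
    have hc1 : c ≤ 1 := (div_le_one hx).2 hlt.le
    have hin : inner ℝ x z ≤ c * ‖x‖ ^ 2 := by
      calc inner ℝ x z ≤ ‖x‖ * ‖z‖ := real_inner_le_norm x z
        _ ≤ ‖x‖ * B := by gcongr
        _ = c * ‖x‖ ^ 2 := by rw [← hcx]; ring
    rw [norm_sub_sq_real, norm_sub_sq_real, norm_smul, real_inner_smul_left, Real.norm_eq_abs,
      abs_of_nonneg hc0]
    nlinarith [mul_le_mul_of_nonneg_left hin (sub_nonneg.2 hc1),
      mul_nonneg (sq_nonneg (1 - c)) (sq_nonneg ‖x‖)]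

end Projection

/-- The level `P` is a fixed point of the drift. With `u = t + t₀`, the excess `Q/u` becomes at most
`Q (u - 1)/u²`, which is below `Q/(u + 1)`; the numerator 2 of the stepsize leaves just enough
contraction to absorb the noise. -/
theorem le_add_div_of_recursion {a : ℕ → ℝ} {P Q V t₀ : ℝ} (ht₀ : 2 ≤ t₀) (hV : 4 * V ≤ Q)
    (h0 : a 0 * t₀ ≤ Q) (hP : 0 ≤ P) (hQ : 0 ≤ Q)
    (hstep : ∀ t : ℕ, a (t + 1) ≤ (1 - 2 / (t + t₀)) * a t + 2 / (t + t₀) * P +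
      4 * V / (t + t₀) ^ 2) (t : ℕ) : a t ≤ P + Q / (t + t₀) := by
  induction t with
  | zero =>
    have : a 0 ≤ Q / t₀ := by rwa [le_div_iff₀ (by linarith)]
    simp only [Nat.cast_zero, zero_add]
    linarith
  | succ t ih =>
    set u : ℝ := t + t₀ with hu
    have hu2 : 2 ≤ u := by
      have : (0 : ℝ) ≤ t := t.cast_nonneg
      linarith
    have hu0 : 0 < u := by linarith
    have e : ((t + 1 : ℕ) : ℝ) + t₀ = u + 1 := by push_cast; ring
    rw [e]
    have h1 : 0 ≤ 1 - 2 / u := by rw [sub_nonneg, div_le_one hu0]; exact hu2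
    refine (hstep t).trans ?_
    calc (1 - 2 / u) * a t + 2 / u * P + 4 * V / u ^ 2
        ≤ (1 - 2 / u) * (P + Q / u) + 2 / u * P + Q / u ^ 2 := by gcongr
      _ = P + Q * ((u - 1) / u ^ 2) := by field_simp; ring
      _ ≤ P + Q * (1 / (u + 1)) := by
          have : (u - 1) / u ^ 2 ≤ 1 / (u + 1) := by
            rw [div_le_div_iff₀ (by positivity) (by positivity)]
            nlinarith
          linarith [mul_le_mul_of_nonneg_left this hQ]
      _ = _ := by ring

/-! ### One period of the algorithm and the resulting error bound. -/

section Update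

variable {S : Type u} {A : Type v} [Fintype S] [Fintype A] [DecidableEq S]
  {M : MDP S A} {π μ : Policy S A} {d : ℕ} {φ : S → EuclideanSpace ℝ (Fin d)} {f dμ : S → ℝ}

/-- Inner product of the expected TD error direction at the state `s` with `z`. -/
noncomputable def driftAt (M : MDP S A) (π : Policy S A) (φ : S → EuclideanSpace ℝ (Fin d))
    (z θ : EuclideanSpace ℝ (Fin d)) (s : S) : ℝ :=
  inner ℝ z (φ s) * (meanReward M π s + M.γ * (transMatrix M π *ᵥ fun k => inner ℝ θ (φ k)) s
    - inner ℝ θ (φ s))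

/-- Under the exact weights `f` the expected update is `Φᵀ F r_π - K θ`, and the first term equals
`K θ*`. -/
theorem sum_mul_driftAt (hu : IsUnit (keyMatrix M π φ f).det) (z θ : EuclideanSpace ℝ (Fin d)) :
    ∑ s, f s * driftAt M π φ z θ s =
      -(z.ofLp ⬝ᵥ (keyMatrix M π φ f *ᵥ (θ - thetaStar M π φ f).ofLp)) := by
  have h1 := dotProduct_transpose_featureMatrix_diagonal_mulVec φ f z (meanReward M π)
  rw [← keyMatrix_mulVec_thetaStar hu] at h1
  have h2 := dotProduct_keyMatrix_mulVec M π φ f z θ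
  rw [WithLp.ofLp_sub, mulVec_sub, dotProduct_sub, h1, h2, neg_sub, ← Finset.sum_sub_distrib]
  refine Finset.sum_congr rfl fun s _ => ?_
  simp only [driftAt]
  ring

theorem abs_inner_feature_le {B : ℝ} {θ : EuclideanSpace ℝ (Fin d)} (hθ : ‖θ‖ ≤ B) (s : S) :
    |inner ℝ θ (φ s)| ≤ Bphi φ * B := by
  refine (abs_real_inner_le_norm _ _).trans ?_
  rw [mul_comm]
  exact mul_le_mul (norm_le_Bphi φ s) hθ (norm_nonneg _) (Bphi_nonneg φ)

theorem abs_tdError_le {B R x y : ℝ} {γ : ℝ} (h0 : 0 < γ) (h1 : γ < 1) {r : ℝ} (hr : |r| ≤ R)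
    (hx : |x| ≤ B) (hy : |y| ≤ B) : |r + γ * x - y| ≤ R + 2 * B := by
  have hB : 0 ≤ B := (abs_nonneg x).trans hx
  have h2 : |γ * x| ≤ B := by
    rw [abs_mul, abs_of_pos h0]
    nlinarith [abs_nonneg x]
  rw [abs_le] at *
  constructor <;> linarith

theorem abs_driftAt_le {B : ℝ} (z : EuclideanSpace ℝ (Fin d)) {θ : EuclideanSpace ℝ (Fin d)}
    (hθ : ‖θ‖ ≤ B) (s : S) :
    |driftAt M π φ z θ s| ≤ Bphi φ * (rMax M + 2 * (Bphi φ * B)) * ‖z‖ := by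
  have h1 : |(transMatrix M π *ᵥ fun k => inner ℝ θ (φ k)) s| ≤ Bphi φ * B := by
    simp only [mulVec, dotProduct]
    refine (Finset.abs_sum_le_sum_abs _ _).trans ?_
    calc ∑ k, |transMatrix M π s k * inner ℝ θ (φ k)|
        ≤ ∑ k, transMatrix M π s k * (Bphi φ * B) := by
          refine Finset.sum_le_sum fun k _ => ?_
          have h0 : 0 ≤ transMatrix M π s k :=
            nonneg_of_mem_rowStochastic (transMatrix_mem_rowStochastic M π)
          rw [abs_mul, abs_of_nonneg h0]
          exact mul_le_mul_of_nonneg_left (abs_inner_feature_le hθ k) h0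
      _ = _ := by
          rw [← Finset.sum_mul,
            sum_row_of_mem_rowStochastic (transMatrix_mem_rowStochastic M π), one_mul]
  have h2 := abs_tdError_le M.γ_pos M.γ_lt_one (abs_meanReward_le (M := M) (π := π) s) h1
    (abs_inner_feature_le (φ := φ) hθ s)
  have h3 : |inner ℝ z (φ s)| ≤ Bphi φ * ‖z‖ := abs_inner_feature_le le_rfl s
  rw [driftAt, abs_mul]
  calc _ ≤ Bphi φ * ‖z‖ * (rMax M + 2 * (Bphi φ * B)) :=
        mul_le_mul h3 h2 (abs_nonneg _) (mul_nonneg (Bphi_nonneg φ) (norm_nonneg _))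
    _ = _ := by ring

/-- Bias and strong monotonicity of the expected update. -/
theorem sum_mul_driftAt_le (hu : IsUnit (keyMatrix M π φ f).det) {m B e : ℝ}
    (hm : ∀ x : EuclideanSpace ℝ (Fin d),
      m * ‖x‖ ^ 2 ≤ x.ofLp ⬝ᵥ (keyMatrix M π φ f *ᵥ x.ofLp)) {k : S → ℝ}
    (hk : ∑ s, |k s - f s| ≤ e) {θ : EuclideanSpace ℝ (Fin d)} (hθ : ‖θ‖ ≤ B) :
    ∑ s, k s * driftAt M π φ (θ - thetaStar M π φ f) θ s ≤
      -m * ‖θ - thetaStar M π φ f‖ ^ 2 +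
        e * (Bphi φ * (rMax M + 2 * (Bphi φ * B))) * ‖θ - thetaStar M π φ f‖ := by
  set z := θ - thetaStar M π φ f with hz
  have h1 := sum_mul_driftAt hu z θ
  have h2 := hm z
  have hb : 0 ≤ Bphi φ * (rMax M + 2 * (Bphi φ * B)) * ‖z‖ := by
    have := Bphi_nonneg φ
    have := rMax_nonneg M
    have := (norm_nonneg θ).trans hθ
    positivity
  have h3 : ∑ s, (k s - f s) * driftAt M π φ z θ s ≤
      e * (Bphi φ * (rMax M + 2 * (Bphi φ * B)) * ‖z‖) := by
    refine le_trans ?_ (mul_le_mul_of_nonneg_right hk hb)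
    rw [Finset.sum_mul]
    refine Finset.sum_le_sum fun s _ => (le_abs_self _).trans ?_
    rw [abs_mul]
    exact mul_le_mul_of_nonneg_left (abs_driftAt_le z hθ s) (abs_nonneg _)
  simp only [sub_mul, Finset.sum_sub_distrib] at h3
  linarith

namespace Trajectory

variable (X : Trajectory.{u, v, w} M μ)

variable {X} in
theorem adapted_update (φ : S → EuclideanSpace ℝ (Fin d)) {n : ℕ}
    {θ : X.Ω → EuclideanSpace ℝ (Fin d)} (hθ : X.Adapted n θ) (b : ℕ) (B η : ℝ) :
    X.Adapted (n + b + 1) fun ω => projBall B (θ ω + (η * X.trace π n b ω *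
      ratio π μ (X.s (n + b) ω) (X.a (n + b) ω) * (M.r (X.s (n + b) ω) (X.a (n + b) ω) +
        M.γ * inner ℝ (θ ω) (φ (X.s (n + b + 1) ω)) - inner ℝ (θ ω) (φ (X.s (n + b) ω)))) •
      φ (X.s (n + b) ω)) := by
  intro ω ω' h
  have h1 := (hθ.mono (by omega : n ≤ n + b + 1)) ω ω' h
  have h2 := ((adapted_trace π n b).mono (by omega : n + b ≤ n + b + 1)) ω ω' h
  have h3 := ((adapted_state (n + b)).mono (by omega : n + b ≤ n + b + 1)) ω ω' h
  have h4 := (adapted_action (by omega : n + b < n + b + 1)) ω ω' h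
  have h5 := (adapted_state (n + b + 1)) ω ω' h
  simp only [h1, h2, h3, h4, h5]

/-- One period of PER-ETD(0) started from a parameter depending on the past. -/
theorem integral_update_le (hcov : Coverage π μ) (hu : IsUnit (keyMatrix M π φ f).det)
    {m B e η : ℝ} (hm0 : 0 < m) (hm : ∀ x : EuclideanSpace ℝ (Fin d),
      m * ‖x‖ ^ 2 ≤ x.ofLp ⬝ᵥ (keyMatrix M π φ f *ᵥ x.ofLp)) (hη : 0 ≤ η)
    (hstar : ‖thetaStar M π φ f‖ ≤ B) {n b : ℕ}
    (hk : ∀ i, ∑ j, |traceKernel M.γ (transMatrix M π) (transMatrix M μ) b i j - f j| ≤ e)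
    {θ : X.Ω → EuclideanSpace ℝ (Fin d)} (hθ : X.Adapted n θ) (hθB : ∀ ω, ‖θ ω‖ ≤ B) :
    ∫ ω, ‖projBall B (θ ω + (η * X.trace π n b ω *
      ratio π μ (X.s (n + b) ω) (X.a (n + b) ω) * (M.r (X.s (n + b) ω) (X.a (n + b) ω) +
        M.γ * inner ℝ (θ ω) (φ (X.s (n + b + 1) ω)) - inner ℝ (θ ω) (φ (X.s (n + b) ω)))) •
      φ (X.s (n + b) ω)) - thetaStar M π φ f‖ ^ 2 ∂X.Pr ≤
    (1 - η * m) * ∫ ω, ‖θ ω - thetaStar M π φ f‖ ^ 2 ∂X.Pr +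
      η * (e * (Bphi φ * (rMax M + 2 * (Bphi φ * B)))) ^ 2 / m +
      η ^ 2 * ((rMax M + 2 * (Bphi φ * B)) ^ 2 * Bphi φ ^ 2 * (rhoMax π μ *
        secondMomentBound (M.γ ^ 2 * rhoMax π μ) (2 * M.γ / (1 - M.γ) + 1) b)) := by
  set D := rMax M + 2 * (Bphi φ * B) with hD
  set θs := thetaStar M π φ f with hθs
  -- Up to the factor `2 η`, this is the cross term of the squared norm. State, action and next
  -- state stay free so that they can be averaged given the past.
  set Ψ : X.Ω → S → A → S → ℝ := fun ω s a y => X.trace π n b ω *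
    (ratio π μ s a * (M.r s a + M.γ * inner ℝ (θ ω) (φ y) - inner ℝ (θ ω) (φ s)) *
      inner ℝ (θ ω - θs) (φ s)) with hΨ
  have hF : X.Adapted (n + b) (X.trace π n b) := adapted_trace π n b
  have hθb : X.Adapted (n + b) θ := hθ.mono (by omega)
  have hΨa : X.Adapted (n + b) Ψ := hF.comp₂ hθb fun F θ s a y => F *
    (ratio π μ s a * (M.r s a + M.γ * inner ℝ θ (φ y) - inner ℝ θ (φ s)) *
      inner ℝ (θ - θs) (φ s))
  have hs : X.Adapted (n + b + 1) (X.s (n + b)) := (adapted_state _).mono (by omega)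
  have ha : X.Adapted (n + b + 1) (X.a (n + b)) := adapted_action (by omega)
  have hΨi : Integrable (fun ω => Ψ ω (X.s (n + b) ω) (X.a (n + b) ω) (X.s (n + b + 1) ω)) X.Pr := by
    have h1 := (hΨa.mono (by omega : n + b ≤ n + b + 1)).comp₂ hs fun ψ s => ψ s
    have h2 := (h1.comp₂ ha fun ψ a => ψ a).comp₂ (adapted_state (n + b + 1)) fun ψ y => ψ y
    exact h2.integrable
  have hx2 : X.Adapted n fun ω => ‖θ ω - θs‖ ^ 2 := hθ.comp fun θ => ‖θ - θs‖ ^ 2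
  have hF2 : X.Adapted (n + b) fun ω => X.trace π n b ω ^ 2 := hF.comp (· ^ 2)
  have hF2ρ : Integrable (fun ω => X.trace π n b ω ^ 2 *
      ratio π μ (X.s (n + b) ω) (X.a (n + b) ω) ^ 2) X.Pr :=
    ((hF2.mono (by omega : n + b ≤ n + b + 1)).mul
      (hs.comp₂ ha fun s a => ratio π μ s a ^ 2)).integrable
  have hdrift : ∫ ω, Ψ ω (X.s (n + b) ω) (X.a (n + b) ω) (X.s (n + b + 1) ω) ∂X.Pr ≤
      ∫ ω, (-m * ‖θ ω - θs‖ ^ 2 + e * (Bphi φ * D) * ‖θ ω - θs‖) ∂X.Pr := by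
    have e1 : ∀ ω s, ∑ a, μ.prob s a * ∑ y, M.P s a y * Ψ ω s a y =
        X.trace π n b ω * driftAt M π φ (θ ω - θs) (θ ω) s := by
      intro ω s
      have e2 : ∀ a, μ.prob s a * ∑ y, M.P s a y * Ψ ω s a y =
          X.trace π n b ω * inner ℝ (θ ω - θs) (φ s) * (M.r s a * π.prob s a +
            M.γ * ∑ y, π.prob s a * M.P s a y * inner ℝ (θ ω) (φ y) -
            inner ℝ (θ ω) (φ s) * π.prob s a) := by
        intro a
        have e3 : ∑ y, M.P s a y * Ψ ω s a y = X.trace π n b ω * inner ℝ (θ ω - θs) (φ s) *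
            ratio π μ s a * ((M.r s a - inner ℝ (θ ω) (φ s)) * ∑ y, M.P s a y +
              M.γ * ∑ y, M.P s a y * inner ℝ (θ ω) (φ y)) := by
          simp only [Finset.mul_sum, ← Finset.sum_add_distrib]
          exact Finset.sum_congr rfl fun y _ => by simp only [hΨ]; ring
        simp only [e3, M.P_sum, mul_assoc (π.prob s a), ← Finset.mul_sum]
        rw [← hcov.mul_ratio]
        ring
      simp only [e2, ← Finset.mul_sum, driftAt, Finset.sum_sub_distrib, Finset.sum_add_distrib,
        π.sum_eq_one, meanReward, mul_one, mulVec, dotProduct, transMatrix, of_apply,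
        Finset.sum_mul]
      rw [Finset.sum_comm]
      ring
    rw [X.integral_step_of_adapted hΨa]
    simp only [e1]
    have hH : ∀ j, X.Adapted n fun ω => driftAt M π φ (θ ω - θs) (θ ω) j :=
      fun j => hθ.comp fun θ => driftAt M π φ (θ - θs) θ j
    rw [X.integral_trace_mul hcov (H := fun j ω => driftAt M π φ (θ ω - θs) (θ ω) j) hH b]
    refine integral_mono ?_ ?_ fun ω => sum_mul_driftAt_le hu hm (hk _) (hθB ω)
    · exact ((adapted_state n).comp₂ hθ fun s θ => ∑ j,
        traceKernel M.γ (transMatrix M π) (transMatrix M μ) b s j *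
          driftAt M π φ (θ - θs) θ j).integrable
    · exact (hθ.comp fun θ => -m * ‖θ - θs‖ ^ 2 + e * (Bphi φ * D) * ‖θ - θs‖).integrable
  -- Young's inequality spends half of the monotonicity on the bias. The bias then enters squared,
  -- for any period length, and the contraction left after doubling is `1 - η m`.
  have hyoung : ∫ ω, (-m * ‖θ ω - θs‖ ^ 2 + e * (Bphi φ * D) * ‖θ ω - θs‖) ∂X.Pr ≤
      -(m / 2) * ∫ ω, ‖θ ω - θs‖ ^ 2 ∂X.Pr + (e * (Bphi φ * D)) ^ 2 / m / 2 := by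
    have : ∫ ω, (-(m / 2) * ‖θ ω - θs‖ ^ 2 + (e * (Bphi φ * D)) ^ 2 / m / 2) ∂X.Pr =
        -(m / 2) * ∫ ω, ‖θ ω - θs‖ ^ 2 ∂X.Pr + (e * (Bphi φ * D)) ^ 2 / m / 2 := by
      rw [integral_add (hx2.integrable.const_mul _) (integrable_const _), integral_const_mul]
      simp
    rw [← this]
    refine integral_mono
      (hθ.comp fun θ => -m * ‖θ - θs‖ ^ 2 + e * (Bphi φ * D) * ‖θ - θs‖).integrable
      ((hx2.integrable.const_mul _).add (integrable_const _)) fun ω => ?_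
    simp only
    set κ := e * (Bphi φ * D)
    set x := ‖θ ω - θs‖
    have h1 : 0 ≤ (m * x - κ) ^ 2 / m / 2 := by positivity
    have h2 : (m * x - κ) ^ 2 / m / 2 = m / 2 * x ^ 2 - κ * x + κ ^ 2 / m / 2 := by
      field_simp
      ring
    linarith
  have hvar : ∫ ω, X.trace π n b ω ^ 2 * ratio π μ (X.s (n + b) ω) (X.a (n + b) ω) ^ 2 ∂X.Pr ≤
      rhoMax π μ * secondMomentBound (M.γ ^ 2 * rhoMax π μ) (2 * M.γ / (1 - M.γ) + 1) b :=
    (X.integral_mul_ratio_sq_le hcov hF2 fun ω => sq_nonneg _).trans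
      (mul_le_mul_of_nonneg_left (X.integral_trace_sq_le hcov n b) rhoMax_nonneg)
  have hpt : ∀ ω, ‖projBall B (θ ω + (η * X.trace π n b ω *
      ratio π μ (X.s (n + b) ω) (X.a (n + b) ω) * (M.r (X.s (n + b) ω) (X.a (n + b) ω) +
        M.γ * inner ℝ (θ ω) (φ (X.s (n + b + 1) ω)) - inner ℝ (θ ω) (φ (X.s (n + b) ω)))) •
      φ (X.s (n + b) ω)) - θs‖ ^ 2 ≤ ‖θ ω - θs‖ ^ 2 +
      (2 * η * Ψ ω (X.s (n + b) ω) (X.a (n + b) ω) (X.s (n + b + 1) ω) +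
      η ^ 2 * (D ^ 2 * Bphi φ ^ 2) * (X.trace π n b ω ^ 2 *
        ratio π μ (X.s (n + b) ω) (X.a (n + b) ω) ^ 2)) := by
    intro ω
    refine (norm_projBall_sub_sq_le hstar _).trans ?_
    set s := X.s (n + b) ω
    set a := X.a (n + b) ω
    set y := X.s (n + b + 1) ω
    set F := X.trace π n b ω
    set δ := M.r s a + M.γ * inner ℝ (θ ω) (φ y) - inner ℝ (θ ω) (φ s) with hδ
    have hδD : |δ| ≤ D := abs_tdError_le M.γ_pos M.γ_lt_one (abs_r_le_rMax s a)
      (abs_inner_feature_le (hθB ω) y) (abs_inner_feature_le (hθB ω) s)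
    have hδ2 : δ ^ 2 ≤ D ^ 2 := sq_le_sq' (abs_le.1 hδD).1 (abs_le.1 hδD).2
    have hφ2 : ‖φ s‖ ^ 2 ≤ Bphi φ ^ 2 := pow_le_pow_left₀ (norm_nonneg _) (norm_le_Bphi φ s) 2
    rw [add_sub_right_comm, norm_add_sq_real, real_inner_smul_right, norm_smul, Real.norm_eq_abs,
      mul_pow, sq_abs]
    have h1 : (η * F * ratio π μ s a * δ) ^ 2 * ‖φ s‖ ^ 2 ≤
        η ^ 2 * (D ^ 2 * Bphi φ ^ 2) * (F ^ 2 * ratio π μ s a ^ 2) := by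
      calc _ = η ^ 2 * (F ^ 2 * ratio π μ s a ^ 2) * (δ ^ 2 * ‖φ s‖ ^ 2) := by ring
        _ ≤ η ^ 2 * (F ^ 2 * ratio π μ s a ^ 2) * (D ^ 2 * Bphi φ ^ 2) := by gcongr
        _ = _ := by ring
    have h2 : Ψ ω s a y = F * (ratio π μ s a * δ * inner ℝ (θ ω - θs) (φ s)) := rfl
    rw [h2]
    linarith
  have iΨ := hΨi.const_mul (2 * η)
  have iv := hF2ρ.const_mul (η ^ 2 * (D ^ 2 * Bphi φ ^ 2))
  have iΨv : Integrable (fun ω => 2 * η * Ψ ω (X.s (n + b) ω) (X.a (n + b) ω)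
      (X.s (n + b + 1) ω) + η ^ 2 * (D ^ 2 * Bphi φ ^ 2) * (X.trace π n b ω ^ 2 *
        ratio π μ (X.s (n + b) ω) (X.a (n + b) ω) ^ 2)) X.Pr := iΨ.add iv
  refine (integral_mono ((adapted_update φ hθ b B η).comp fun θ => ‖θ - θs‖ ^ 2).integrable
    (hx2.integrable.add iΨv) hpt).trans ?_
  simp only [Pi.add_apply]
  rw [integral_add hx2.integrable iΨv, integral_add iΨ iv, integral_const_mul, integral_const_mul]
  have h1 := mul_le_mul_of_nonneg_left (hdrift.trans hyoung) (by positivity : 0 ≤ 2 * η)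
  have h2 := mul_le_mul_of_nonneg_left hvar
    (by positivity : 0 ≤ η ^ 2 * (D ^ 2 * Bphi φ ^ 2))
  have e3 : 2 * η * (-(m / 2) * ∫ ω, ‖θ ω - θs‖ ^ 2 ∂X.Pr + (e * (Bphi φ * D)) ^ 2 / m / 2) =
      -(η * m) * ∫ ω, ‖θ ω - θs‖ ^ 2 ∂X.Pr + η * (e * (Bphi φ * D)) ^ 2 / m := by ring
  linarith

end Trajectory

theorem one_le_secondMomentBound {q c : ℝ} (hq : 0 ≤ q) (hc : 1 ≤ c) (b : ℕ) :
    1 ≤ secondMomentBound q c b := by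
  induction b with
  | zero => exact le_rfl
  | succ b ih =>
    simp only [secondMomentBound]
    nlinarith

/-- Error bound of PER-ETD(0) for arbitrary period length and number of iterations. -/
theorem exists_accurate (hφ : LinearIndependent ℝ (featureMatrix φ).col) (hcov : Coverage π μ)
    (hd : ∀ s, 0 < dμ s) (hf : IsEmphasis M.γ (transMatrix M π) dμ f) {CM χ : ℝ}
    (hG : IsGeometricRate (transMatrix M μ) dμ CM χ) (hne : χ ≠ M.γ) :
    ∃ c : ℝ, 0 ≤ c ∧ ∀ b T : ℕ, 1 ≤ T → ∀ X : Trajectory.{u, v, w} M μ,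
      X.Accurate π φ f b T (c * ((xi M χ ^ b) ^ 2 +
        secondMomentBound (M.γ ^ 2 * rhoMax π μ) (2 * M.γ / (1 - M.γ) + 1) b / T)) := by
  have hγ0 := M.γ_pos
  have hγ1 : 0 < 1 - M.γ := by linarith [M.γ_lt_one]
  have hV1 : ∀ b, 1 ≤ secondMomentBound (M.γ ^ 2 * rhoMax π μ) (2 * M.γ / (1 - M.γ) + 1) b :=
    one_le_secondMomentBound (mul_nonneg (sq_nonneg _) Trajectory.rhoMax_nonneg)
      (by have : 0 ≤ 2 * M.γ / (1 - M.γ) := by positivity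
          linarith)
  -- Without coordinates `μ₀` has no meaning, but the parameter space is a point and the error
  -- vanishes.
  rcases Nat.eq_zero_or_pos d with rfl | hd0
  · refine ⟨0, le_rfl, fun b T _ X => ?_⟩
    have h0 : X.sqError π φ f b T = fun _ => 0 := by
      funext ω
      rw [Trajectory.sqError, Subsingleton.elim (iterate M π μ φ (Btheta M π φ f)
        (stepsize M π φ f) b (fun k => X.s k ω) (fun k => X.a k ω) T) (thetaStar M π φ f)]
      simp
    rw [Trajectory.Accurate, h0]
    simp
  obtain ⟨hm0, hm⟩ := mu0_spec hφ hd hf hd0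
  have hu := isUnit_det_keyMatrix hφ hd hf
  have hstar := norm_thetaStar_le hφ hd hf
  have hL := mu0_le_L0 hφ hd hf hd0
  set m := mu0 M π φ f with hmdef
  set B := Btheta M π φ f with hB
  have hB0 : 0 ≤ B := (norm_nonneg _).trans hstar
  set t₀ := t0 M π φ f with ht₀
  have ht₀8 : 8 ≤ t₀ := by
    rw [ht₀, t0, le_div_iff₀ (by positivity)]
    have : m ^ 2 ≤ L0 M π φ f ^ 2 := pow_le_pow_left₀ hm0.le hL 2
    linarith
  set D := rMax M + 2 * (Bphi φ * B) with hD
  set κ := CM / |χ - M.γ| + (1 + ∑ s, |f s|) with hκ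
  set W := D ^ 2 * Bphi φ ^ 2 * rhoMax π μ with hW
  have hW0 : 0 ≤ W := mul_nonneg (by positivity) Trajectory.rhoMax_nonneg
  set V := secondMomentBound (M.γ ^ 2 * rhoMax π μ) (2 * M.γ / (1 - M.γ) + 1) with hV
  set ρ := (κ * (Bphi φ * D)) ^ 2 / m ^ 2 with hρ
  -- The summands account for squared bias, accumulated noise and the initial error `‖θ*‖² ≤ B²`.
  refine ⟨ρ + (4 * W / m ^ 2 + B ^ 2 * t₀), by positivity, fun b T hT X => ?_⟩
  set θ : ℕ → X.Ω → EuclideanSpace ℝ (Fin d) := fun t ω =>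
    iterate M π μ φ B (stepsize M π φ f) b (fun k => X.s k ω) (fun k => X.a k ω) t with hθ
  have hsucc : ∀ t ω, θ (t + 1) ω = projBall B (θ t ω + (stepsize M π φ f t *
      X.trace π (t * (b + 1)) b ω *
      ratio π μ (X.s (t * (b + 1) + b) ω) (X.a (t * (b + 1) + b) ω) *
      (M.r (X.s (t * (b + 1) + b) ω) (X.a (t * (b + 1) + b) ω) +
        M.γ * inner ℝ (θ t ω) (φ (X.s (t * (b + 1) + b + 1) ω)) -
          inner ℝ (θ t ω) (φ (X.s (t * (b + 1) + b) ω)))) •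
      φ (X.s (t * (b + 1) + b) ω)) := fun t ω => rfl
  have hadapt : ∀ t, X.Adapted (t * (b + 1)) (θ t) := by
    intro t
    induction t with
    | zero => exact Trajectory.adapted_const _ _
    | succ t ih =>
      have h1 := Trajectory.adapted_update (π := π) φ ih b B (stepsize M π φ f t)
      rw [show (t + 1) * (b + 1) = t * (b + 1) + b + 1 by ring]
      rw [funext (hsucc t)]
      exact h1
  have hbound : ∀ t ω, ‖θ t ω‖ ≤ B := by
    intro t ω
    cases t with
    | zero => simpa [hθ, iterate] using hB0
    | succ t => rw [hsucc]; exact norm_projBall_le hB0 _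
  have hk := sum_abs_traceKernel_sub_le M.γ_pos (transMatrix_mem_rowStochastic M π) hf hG hne b
  refine ⟨((hadapt T).comp fun θ => ‖θ - thetaStar M π φ f‖ ^ 2).integrable, ?_⟩
  have hξ0 : 0 ≤ xi M χ := hγ0.le.trans (le_max_left _ _)
  have key := le_add_div_of_recursion (a := fun t => ∫ ω, ‖θ t ω - thetaStar M π φ f‖ ^ 2 ∂X.Pr)
    (P := ρ * (xi M χ ^ b) ^ 2) (Q := (4 * W / m ^ 2 + B ^ 2 * t₀) * V b) (V := W * V b / m ^ 2)
    (t₀ := t₀) (by linarith) ?_ ?_ (by positivity) ?_ ?_ T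
  · refine key.trans ?_
    have hTpos : (0 : ℝ) < T := by exact_mod_cast hT
    have hVb := hV1 b
    calc ρ * (xi M χ ^ b) ^ 2 + (4 * W / m ^ 2 + B ^ 2 * t₀) * V b / (T + t₀)
        ≤ ρ * (xi M χ ^ b) ^ 2 + (4 * W / m ^ 2 + B ^ 2 * t₀) * V b / T := by
          gcongr
          linarith
      _ = ρ * (xi M χ ^ b) ^ 2 + (4 * W / m ^ 2 + B ^ 2 * t₀) * (V b / T) := by ring
      _ ≤ (ρ + (4 * W / m ^ 2 + B ^ 2 * t₀)) * (xi M χ ^ b) ^ 2 +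
          (ρ + (4 * W / m ^ 2 + B ^ 2 * t₀)) * (V b / T) := by
          have h1 : 0 ≤ ρ * (V b / T) := by positivity
          have h2 : 0 ≤ (4 * W / m ^ 2 + B ^ 2 * t₀) * (xi M χ ^ b) ^ 2 := by positivity
          linarith
      _ = _ := by ring
  · have : 0 ≤ B ^ 2 * t₀ * V b := by have := hV1 b; positivity
    have e : 4 * (W * V b / m ^ 2) = 4 * W / m ^ 2 * V b := by ring
    rw [e]
    linarith
  · have e0 : ∀ ω, θ 0 ω = 0 := fun ω => rfl
    have h1 : ‖thetaStar M π φ f‖ ^ 2 * t₀ ≤ B ^ 2 * t₀ := by gcongr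
    have h2 : 0 ≤ 4 * W / m ^ 2 := by positivity
    have h3 : 0 ≤ B ^ 2 * t₀ := by positivity
    simp only [e0, zero_sub, norm_neg, integral_const, probReal_univ, one_smul]
    nlinarith [hV1 b]
  · have := hV1 b
    positivity
  · intro t
    have hu0 : 0 < (t : ℝ) + t₀ := by
      have : (0 : ℝ) ≤ t := t.cast_nonneg
      linarith
    have hη : 0 ≤ stepsize M π φ f t := by
      rw [stepsize]
      positivity
    have h := X.integral_update_le (n := t * (b + 1)) hcov hu hm0 hm hη hstar hk (hadapt t)
      (hbound t)
    simp only [hsucc]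
    refine h.trans (le_of_eq ?_)
    have e1 : stepsize M π φ f t = 2 / (m * (t + t₀)) := rfl
    have e2 : max M.γ χ = xi M χ := rfl
    have e3 : secondMomentBound (M.γ ^ 2 * rhoMax π μ) (2 * M.γ / (1 - M.γ) + 1) b = V b := rfl
    rw [e1, e2, e3, ← hD, ← hκ]
    simp only [hρ, hW]
    generalize ∫ ω, ‖θ t ω - thetaStar M π φ f‖ ^ 2 ∂X.Pr = I
    field_simp
    ring

end Update

/-! ### Growth of the moment bound, period lengths, and inversion of the rates. -/

section Rates

theorem secondMomentBound_le_linear {q c : ℝ} (hq : 0 ≤ q) (hq1 : q ≤ 1) (hc : 1 ≤ c) (b : ℕ) :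
    secondMomentBound q c b ≤ 1 + c * b := by
  induction b with
  | zero => simp [secondMomentBound]
  | succ b ih =>
    have := one_le_secondMomentBound hq hc b
    simp only [secondMomentBound]
    push_cast
    nlinarith

/-- Shifted by `c/(q - 1)`, the affine recursion is exactly geometric. -/
theorem secondMomentBound_le_pow {q c : ℝ} (hq1 : 1 < q) (hc : 0 ≤ c) (b : ℕ) :
    secondMomentBound q c b ≤ (1 + c / (q - 1)) * q ^ b := by
  have hq : 0 < q - 1 := by linarith
  have e : secondMomentBound q c b + c / (q - 1) = (1 + c / (q - 1)) * q ^ b := by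
    induction b with
    | zero => simp [secondMomentBound]
    | succ b ih =>
      rw [pow_succ, ← mul_assoc, ← ih, secondMomentBound]
      field_simp
      ring
  have : 0 ≤ c / (q - 1) := by positivity
  linarith

theorem le_max_ceil_log (b₀ T : ℕ) (D : ℝ) :
    Real.log T / D ≤ (max b₀ ⌈Real.log T / D⌉₊ : ℕ) :=
  (Nat.le_ceil _).trans (by exact_mod_cast le_max_right _ _)

theorem max_ceil_log_le (b₀ T : ℕ) {D : ℝ} (hD : 0 < D) :
    ((max b₀ ⌈Real.log T / D⌉₊ : ℕ) : ℝ) ≤ b₀ + 1 + Real.log T / D := by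
  have h0 : 0 ≤ Real.log T / D := div_nonneg (Real.log_natCast_nonneg T) hD.le
  have h1 := Nat.ceil_lt_add_one h0
  have h2 : ((max b₀ ⌈Real.log T / D⌉₊ : ℕ) : ℝ) ≤ b₀ + ⌈Real.log T / D⌉₊ := by
    exact_mod_cast max_le (Nat.le_add_right _ _) (Nat.le_add_left _ _)
  linarith

theorem pow_le_rpow_neg {ξ D : ℝ} (h0 : 0 < ξ) (h1 : ξ < 1) {T b : ℕ} (hT : 1 ≤ T)
    (hb : Real.log T / D ≤ b) : ξ ^ b ≤ (T : ℝ) ^ (-(Real.log (1 / ξ) / D)) := by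
  have hT0 : (0 : ℝ) < T := by exact_mod_cast hT
  have hl : 0 < Real.log (1 / ξ) := Real.log_pos (by rw [lt_div_iff₀ h0]; linarith)
  have hl' : Real.log ξ = -Real.log (1 / ξ) := by rw [one_div, Real.log_inv, neg_neg]
  rw [← Real.rpow_natCast, Real.rpow_def_of_pos h0, Real.rpow_def_of_pos hT0, Real.exp_le_exp, hl']
  have := mul_le_mul_of_nonneg_left hb hl.le
  have e : Real.log T * -(Real.log (1 / ξ) / D) = -(Real.log (1 / ξ) * (Real.log T / D)) := by ring
  rw [e]
  linarith

/-- Selects the constant in `T = ⌈K x log x⌉`, `x = 1/ε`: the logarithm of `T` involves `K` again,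
so `K` must dominate a multiple of its own logarithm. -/
theorem exists_log_le_linear (C : ℝ) (hC : 0 < C) :
    ∃ K : ℝ, 4 ≤ K ∧ C * (Real.log (2 * K) / Real.log 2 + 2) ≤ K := by
  have hl2 : 0 < Real.log 2 := Real.log_pos one_lt_two
  have h1 := Real.isLittleO_log_id_atTop.def (c := Real.log 2 / (4 * C)) (by positivity)
  obtain ⟨y, hy, hy8, hyC⟩ := (h1.and ((eventually_ge_atTop 8).and
    (eventually_ge_atTop (8 * C)))).exists
  refine ⟨y / 2, by linarith, ?_⟩
  have h2 : Real.log y ≤ Real.log 2 / (4 * C) * y := by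
    have h3 := (le_abs_self _).trans hy
    simpa [abs_of_nonneg (by linarith : (0 : ℝ) ≤ y)] using h3
  rw [mul_div_cancel₀ y two_ne_zero]
  have h4 : C * (Real.log y / Real.log 2) ≤ y / 4 := by
    calc C * (Real.log y / Real.log 2) ≤ C * (Real.log 2 / (4 * C) * y / Real.log 2) := by gcongr
      _ = y / 4 := by field_simp
  linarith

theorem half_le_log_two : (1 : ℝ) / 2 ≤ Real.log 2 := by
  linarith [Real.log_two_gt_d9]

/-- `log T / T` is at most `ε` for some `T = Õ(1/ε)`. -/
theorem exists_iterations_of_log_div (C D : ℝ) (hC : 0 < C) (hD : 0 < D) (b₀ : ℕ) :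
    ∃ C' : ℝ, ∀ ε : ℝ, 0 < ε → ε ≤ 1 / 2 → ∃ T : ℕ, 2 ≤ T ∧ C * Real.log T / T ≤ ε ∧
      (T : ℝ) * ((max b₀ ⌈Real.log T / D⌉₊ : ℕ) + 1) ≤ C' * (1 / ε) * Real.log (1 / ε) ^ 2 := by
  obtain ⟨K, hK4, hK⟩ := exists_log_le_linear C hC
  have hl2 := half_le_log_two
  refine ⟨2 * K * (2 * (b₀ + 2) + K / (C * D)), fun ε hε hε2 => ?_⟩
  set x := 1 / ε with hx
  set L := Real.log x with hL
  have hx2 : 2 ≤ x := by rw [hx, le_div_iff₀ hε]; linarith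
  have hL2 : Real.log 2 ≤ L := Real.log_le_log two_pos hx2
  have hLx : L ≤ x := (Real.log_le_sub_one_of_pos (by linarith)).trans (by linarith)
  have hL0 : 0 < L := by linarith
  have hy : 4 ≤ K * L * x := by
    have : 2 ≤ K * L := by nlinarith
    nlinarith
  have hle : K * L * x ≤ (⌈K * L * x⌉₊ : ℝ) := Nat.le_ceil _
  have hlt : (⌈K * L * x⌉₊ : ℝ) < K * L * x + 1 := Nat.ceil_lt_add_one (by linarith)
  set T := ⌈K * L * x⌉₊ with hT
  have hT4 : (4 : ℝ) ≤ T := hy.trans hle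
  have hT2 : (T : ℝ) ≤ 2 * (K * L * x) := by linarith
  -- Since `T ≤ 2 K x²`, its logarithm is at most `log (2K) + 2L`. As `L ≥ log 2`, the constant
  -- becomes a multiple of `L`, and the choice of `K` closes the estimate.
  have hlogT : C * Real.log T ≤ K * L := by
    have h1 : Real.log T ≤ Real.log (2 * K) + 2 * L := by
      have h2 : (T : ℝ) ≤ 2 * K * x ^ 2 := by
        have : K * L * x ≤ K * x * x := by gcongr
        linarith
      refine (Real.log_le_log (by linarith) h2).trans (le_of_eq ?_)
      rw [Real.log_mul (by positivity) (by positivity), Real.log_pow]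
      push_cast
      rfl
    have h3 : Real.log (2 * K) ≤ Real.log (2 * K) / Real.log 2 * L := by
      rw [div_mul_eq_mul_div, le_div_iff₀ (by linarith)]
      exact mul_le_mul_of_nonneg_left hL2 (Real.log_nonneg (by linarith))
    calc C * Real.log T ≤ C * (Real.log (2 * K) / Real.log 2 * L + 2 * L) := by
          gcongr; linarith
      _ = C * (Real.log (2 * K) / Real.log 2 + 2) * L := by ring
      _ ≤ K * L := by gcongr
  refine ⟨T, by exact_mod_cast (by linarith : (2 : ℝ) ≤ T), ?_, ?_⟩
  · rw [div_le_iff₀ (by linarith)]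
    have e : ε * (K * L * x) = K * L := by rw [hx]; field_simp
    have := mul_le_mul_of_nonneg_left hle hε.le
    linarith
  · have hb := max_ceil_log_le b₀ T hD
    have h1 : Real.log T / D ≤ K / (C * D) * L := by
      have e : K / (C * D) * L = K * L / C / D := by field_simp
      rw [e]
      gcongr
      rw [le_div_iff₀ hC]
      linarith
    have h2 : (b₀ : ℝ) + 2 ≤ 2 * (b₀ + 2) * L := by
      have : (0 : ℝ) ≤ b₀ := b₀.cast_nonneg
      nlinarith
    calc (T : ℝ) * ((max b₀ ⌈Real.log T / D⌉₊ : ℕ) + 1)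
        ≤ 2 * (K * L * x) * (2 * (b₀ + 2) * L + K / (C * D) * L) := by
          exact mul_le_mul hT2 (by linarith) (by positivity) (by linarith)
      _ = _ := by ring

/-- `T ^ (-a)` is at most `ε` for some `T` of order `ε ^ (-1 / a)`. -/
theorem exists_iterations_of_rpow (C D a : ℝ) (hC : 1 ≤ C) (hD : 0 < D) (ha : 0 < a) (b₀ : ℕ) :
    ∃ C' : ℝ, ∀ ε : ℝ, 0 < ε → ε ≤ 1 / 2 → ∃ T : ℕ, 1 ≤ T ∧ C / (T : ℝ) ^ a ≤ ε ∧
      (T : ℝ) * ((max b₀ ⌈Real.log T / D⌉₊ : ℕ) + 1) ≤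
        C' * (1 / ε) ^ (1 / a) * Real.log (1 / ε) ^ 1 := by
  have hl2 := half_le_log_two
  -- Chosen so that `(K x^{1/a})^a = C x`, which is exactly what accuracy `1/x` requires.
  set K := C ^ (1 / a) with hK
  have hK1 : 1 ≤ K := Real.one_le_rpow hC (by positivity)
  refine ⟨2 * K * (2 * (b₀ + 2 + Real.log (2 * K) / D) + 1 / a / D), fun ε hε hε2 => ?_⟩
  set x := 1 / ε with hx
  set L := Real.log x with hL
  have hx2 : 2 ≤ x := by rw [hx, le_div_iff₀ hε]; linarith
  have hL2 : Real.log 2 ≤ L := Real.log_le_log two_pos hx2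
  have hL0 : 0 < L := by linarith
  have hxa : 1 ≤ x ^ (1 / a) := Real.one_le_rpow (by linarith) (by positivity)
  have hy : 1 ≤ K * x ^ (1 / a) := one_le_mul_of_one_le_of_one_le hK1 hxa
  have hle : K * x ^ (1 / a) ≤ (⌈K * x ^ (1 / a)⌉₊ : ℝ) := Nat.le_ceil _
  have hlt : (⌈K * x ^ (1 / a)⌉₊ : ℝ) < K * x ^ (1 / a) + 1 := Nat.ceil_lt_add_one (by linarith)
  set T := ⌈K * x ^ (1 / a)⌉₊ with hT
  have hT1 : (1 : ℝ) ≤ T := hy.trans hle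
  have hT2 : (T : ℝ) ≤ 2 * K * x ^ (1 / a) := by linarith
  refine ⟨T, by exact_mod_cast hT1, ?_, ?_⟩
  · have h1 : C * x ≤ (T : ℝ) ^ a := by
      calc C * x = (K * x ^ (1 / a)) ^ a := by
            rw [hK, ← Real.mul_rpow (by linarith) (by linarith), ← Real.rpow_mul (by positivity),
              one_div_mul_cancel ha.ne', Real.rpow_one]
        _ ≤ (T : ℝ) ^ a := Real.rpow_le_rpow (by linarith) hle ha.le
    rw [div_le_iff₀ (by positivity)]
    have e : ε * (C * x) = C := by rw [hx]; field_simp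
    have := mul_le_mul_of_nonneg_left h1 hε.le
    linarith
  · have hb := max_ceil_log_le b₀ T hD
    have h1 : Real.log T ≤ Real.log (2 * K) + 1 / a * L := by
      refine (Real.log_le_log (by linarith) hT2).trans (le_of_eq ?_)
      rw [Real.log_mul (by positivity) (by positivity), Real.log_rpow (by linarith)]
    have h2 : Real.log T / D ≤ Real.log (2 * K) / D + 1 / a / D * L := by
      have e : Real.log (2 * K) / D + 1 / a / D * L = (Real.log (2 * K) + 1 / a * L) / D := by ring
      rw [e]
      gcongr
    have h3 : (b₀ : ℝ) + 2 + Real.log (2 * K) / D ≤ 2 * (b₀ + 2 + Real.log (2 * K) / D) * L := by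
      have h4 : 0 ≤ (b₀ : ℝ) + 2 + Real.log (2 * K) / D := by
        have := Real.log_nonneg (by linarith : 1 ≤ 2 * K)
        positivity
      nlinarith
    calc (T : ℝ) * ((max b₀ ⌈Real.log T / D⌉₊ : ℕ) + 1)
        ≤ 2 * K * x ^ (1 / a) *
          (2 * (b₀ + 2 + Real.log (2 * K) / D) * L + 1 / a / D * L) := by
          exact mul_le_mul hT2 (by linarith) (by positivity) (by positivity)
      _ = _ := by ring

end Rates

/-! ### Error rates for the prescribed periods. -/

section Complexity

variable {S : Type u} {A : Type v} [Fintype S] [Fintype A] [DecidableEq S]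
  {M : MDP S A} {π μ : Policy S A} {d : ℕ} {φ : S → EuclideanSpace ℝ (Fin d)} {f dμ : S → ℝ}

theorem Trajectory.Accurate.mono {X : Trajectory.{u, v, w} M μ} {b T : ℕ} {ε ε' : ℝ}
    (h : X.Accurate π φ f b T ε) (hε : ε ≤ ε') : X.Accurate π φ f b T ε' :=
  ⟨h.1, h.2.trans hε⟩

theorem xi_pos (M : MDP S A) (χ : ℝ) : 0 < xi M χ := M.γ_pos.trans_le (le_max_left _ _)

theorem xi_lt_one {χ : ℝ} (h : χ < 1) : xi M χ < 1 := max_lt M.γ_lt_one h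

theorem log_one_div_xi_pos {χ : ℝ} (h : χ < 1) : 0 < Real.log (1 / xi M χ) :=
  Real.log_pos (by rw [lt_div_iff₀ (xi_pos M χ), one_mul]; exact xi_lt_one h)

theorem rateExp_eq {χ : ℝ} (h : χ < 1) : rateExp M π μ χ = Real.log (1 / xi M χ) /
    (Real.log (M.γ ^ 2 * rhoMax π μ) + Real.log (1 / xi M χ)) := by
  have := log_one_div_xi_pos (M := M) h
  rw [rateExp, Real.logb, div_add_one this.ne', one_div_div]

theorem one_le_traceConstant (M : MDP S A) : 1 ≤ 2 * M.γ / (1 - M.γ) + 1 := by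
  have := M.γ_pos
  have : 0 < 1 - M.γ := by linarith [M.γ_lt_one]
  have : 0 ≤ 2 * M.γ / (1 - M.γ) := by positivity
  linarith

/-- Error rate with logarithmic period when `γ² ρ_max ≤ 1`. -/
theorem exists_accurate_periodLow (hφ : LinearIndependent ℝ (featureMatrix φ).col)
    (hcov : Coverage π μ) (hd : ∀ s, 0 < dμ s) (hf : IsEmphasis M.γ (transMatrix M π) dμ f)
    {CM χ : ℝ} (hG : IsGeometricRate (transMatrix M μ) dμ CM χ) (hne : χ ≠ M.γ)
    (hq : M.γ ^ 2 * rhoMax π μ ≤ 1) :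
    ∃ C : ℝ, 0 < C ∧ ∀ T : ℕ, 2 ≤ T → ∀ X : Trajectory.{u, v, w} M μ,
      X.Accurate π φ f (periodLow M π φ f CM χ T) T (C * Real.log T / T) := by
  obtain ⟨c, hc, hacc⟩ := exists_accurate.{u, v, w} hφ hcov hd hf hG hne
  have hℓ := log_one_div_xi_pos (M := M) hG.χ_lt_one
  set ℓ := Real.log (1 / xi M χ) with hℓdef
  set k := 2 * M.γ / (1 - M.γ) + 1 with hk
  have hk1 : 1 ≤ k := one_le_traceConstant M
  set b₀ := basePeriod M π φ f CM χ with hb₀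
  have hb₀0 : (0 : ℝ) ≤ b₀ := b₀.cast_nonneg
  refine ⟨c * (2 * (2 + k * (b₀ + 1)) + k / ℓ) + 1, by positivity, fun T hT X => ?_⟩
  refine (hacc _ T (by omega) X).mono ?_
  have hb1 := le_max_ceil_log b₀ T ℓ
  have hb2 := max_ceil_log_le b₀ T hℓ
  have hper : periodLow M π φ f CM χ T = max b₀ ⌈Real.log T / ℓ⌉₊ := rfl
  rw [hper]
  set b := max b₀ ⌈Real.log T / ℓ⌉₊
  have hT2 : (2 : ℝ) ≤ T := by exact_mod_cast hT
  have hT0 : (0 : ℝ) < T := by linarith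
  have hlog : 1 / 2 ≤ Real.log T := half_le_log_two.trans (Real.log_le_log two_pos hT2)
  -- The period already gives `ξ^b ≤ 1/T`, so the square is simply dropped.
  have h1 : (xi M χ ^ b) ^ 2 ≤ 1 / T := by
    have h2 := pow_le_rpow_neg (xi_pos M χ) (xi_lt_one hG.χ_lt_one) (by omega : 1 ≤ T) hb1
    rw [div_self hℓ.ne', Real.rpow_neg_one, ← one_div] at h2
    have h3 : xi M χ ^ b ≤ 1 := pow_le_one₀ (xi_pos M χ).le (xi_lt_one hG.χ_lt_one).le
    have h4 : 0 ≤ xi M χ ^ b := pow_nonneg (xi_pos M χ).le b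
    nlinarith
  have h2 := secondMomentBound_le_linear
    (mul_nonneg (sq_nonneg M.γ) (Trajectory.rhoMax_nonneg (π := π) (μ := μ))) hq hk1 b
  have h3 : secondMomentBound (M.γ ^ 2 * rhoMax π μ) k b ≤
      1 + k * (b₀ + 1 + Real.log T / ℓ) := by
    have := mul_le_mul_of_nonneg_left hb2 (by linarith : 0 ≤ k)
    linarith
  calc c * ((xi M χ ^ b) ^ 2 + secondMomentBound (M.γ ^ 2 * rhoMax π μ) k b / T)
      ≤ c * (1 / T + (1 + k * (b₀ + 1 + Real.log T / ℓ)) / T) := by gcongr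
    _ = c * ((2 + k * (b₀ + 1)) + k / ℓ * Real.log T) / T := by field_simp; ring
    _ ≤ c * (2 * (2 + k * (b₀ + 1)) * Real.log T + k / ℓ * Real.log T) / T := by
        gcongr
        have : 0 ≤ 2 + k * (b₀ + 1) := by positivity
        nlinarith
    _ = (c * (2 * (2 + k * (b₀ + 1)) + k / ℓ)) * Real.log T / T := by ring
    _ ≤ _ := by
        gcongr
        linarith

theorem rateExp_mem_Ioo {χ : ℝ} (h : χ < 1) (hq : 1 < M.γ ^ 2 * rhoMax π μ) :
    0 < rateExp M π μ χ ∧ rateExp M π μ χ < 1 := by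
  have hℓ := log_one_div_xi_pos (M := M) h
  have hlq := Real.log_pos hq
  rw [rateExp_eq h]
  exact ⟨by positivity, by rw [div_lt_one (by positivity)]; linarith⟩

/-- Error rate with logarithmic period when `γ² ρ_max > 1`. -/
theorem exists_accurate_periodHigh (hφ : LinearIndependent ℝ (featureMatrix φ).col)
    (hcov : Coverage π μ) (hd : ∀ s, 0 < dμ s) (hf : IsEmphasis M.γ (transMatrix M π) dμ f)
    {CM χ : ℝ} (hG : IsGeometricRate (transMatrix M μ) dμ CM χ) (hne : χ ≠ M.γ)
    (hq : 1 < M.γ ^ 2 * rhoMax π μ) :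
    ∃ C : ℝ, 1 ≤ C ∧ ∀ T : ℕ, 1 ≤ T → ∀ X : Trajectory.{u, v, w} M μ,
      X.Accurate π φ f (periodHigh M π μ φ f CM χ T) T (C / (T : ℝ) ^ rateExp M π μ χ) := by
  obtain ⟨c, hc, hacc⟩ := exists_accurate.{u, v, w} hφ hcov hd hf hG hne
  have ha := rateExp_eq (M := M) (π := π) (μ := μ) hG.χ_lt_one
  have hℓ := log_one_div_xi_pos (M := M) hG.χ_lt_one
  have hlq := Real.log_pos hq
  set ℓ := Real.log (1 / xi M χ) with hℓdef
  set k := 2 * M.γ / (1 - M.γ) + 1 with hk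
  have hk1 : 1 ≤ k := one_le_traceConstant M
  set q := M.γ ^ 2 * rhoMax π μ with hqdef
  have hq0 : 0 < q := by linarith
  set D := Real.log q + ℓ with hD
  have hD0 : 0 < D := by positivity
  set a := rateExp M π μ χ with hadef
  set b₀ := basePeriod M π φ f CM χ with hb₀
  have hK : 0 ≤ 1 + k / (q - 1) := by
    have : 0 < q - 1 := by linarith
    positivity
  refine ⟨c * (1 + (1 + k / (q - 1)) * q ^ (b₀ + 1)) + 1, ?_, fun T hT X => ?_⟩
  · have : 0 ≤ c * (1 + (1 + k / (q - 1)) * q ^ (b₀ + 1)) := by positivity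
    linarith
  refine (hacc _ T hT X).mono ?_
  have hb1 := le_max_ceil_log b₀ T D
  have hb2 := max_ceil_log_le b₀ T hD0
  have hper : periodHigh M π μ φ f CM χ T = max b₀ ⌈Real.log T / D⌉₊ := rfl
  rw [hper]
  set b := max b₀ ⌈Real.log T / D⌉₊
  have hT0 : (0 : ℝ) < T := by exact_mod_cast hT
  have hTa : 0 < (T : ℝ) ^ a := by positivity
  have h1 : (xi M χ ^ b) ^ 2 ≤ 1 / (T : ℝ) ^ a := by
    have h2 := pow_le_rpow_neg (xi_pos M χ) (xi_lt_one hG.χ_lt_one) hT hb1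
    rw [← hℓdef, ← ha, Real.rpow_neg hT0.le, ← one_div] at h2
    have h3 : xi M χ ^ b ≤ 1 := pow_le_one₀ (xi_pos M χ).le (xi_lt_one hG.χ_lt_one).le
    have h4 : 0 ≤ xi M χ ^ b := pow_nonneg (xi_pos M χ).le b
    nlinarith
  have h2 := secondMomentBound_le_pow hq (by linarith : 0 ≤ k) b
  -- The period is at most `b₀ + 1 + log T / D`, and `q^{log T / D} = T^{1 - a}` because `log q = D
  -- - ℓ` and `a = ℓ/D`. The base period and the rounding cost only a constant factor.
  have h3 : q ^ b ≤ q ^ (b₀ + 1) * (T / (T : ℝ) ^ a) := by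
    have e1 : q ^ (Real.log T / D) = T / (T : ℝ) ^ a := by
      rw [div_eq_mul_inv (T : ℝ), ← Real.rpow_neg hT0.le]
      nth_rewrite 2 [← Real.rpow_one (T : ℝ)]
      rw [← Real.rpow_add hT0, Real.rpow_def_of_pos hq0, Real.rpow_def_of_pos hT0, ha]
      congr 1
      have : Real.log q = D - ℓ := by rw [hD]; ring
      rw [this]
      field_simp
      ring
    rw [← e1, ← Real.rpow_natCast q b, ← Real.rpow_natCast q (b₀ + 1), ← Real.rpow_add hq0]
    refine Real.rpow_le_rpow_of_exponent_le hq.le ?_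
    push_cast
    exact hb2
  have h4 : secondMomentBound q k b / T ≤ (1 + k / (q - 1)) * q ^ (b₀ + 1) * (1 / (T : ℝ) ^ a) := by
    rw [div_le_iff₀ hT0]
    refine (h2.trans (mul_le_mul_of_nonneg_left h3 hK)).trans (le_of_eq ?_)
    field_simp
  calc c * ((xi M χ ^ b) ^ 2 + secondMomentBound q k b / T)
      ≤ c * (1 / (T : ℝ) ^ a + (1 + k / (q - 1)) * q ^ (b₀ + 1) * (1 / (T : ℝ) ^ a)) := by
        gcongr
    _ = c * (1 + (1 + k / (q - 1)) * q ^ (b₀ + 1)) / (T : ℝ) ^ a := by ring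
    _ ≤ _ := by
        gcongr
        linarith

end Complexity

end PerETD

/-! ### The main theorem. -/

theorem theorem1 {S : Type u} {A : Type v} [Fintype S] [Nonempty S] [DecidableEq S] [Fintype A]
    (M : MDP S A) (π μ : Policy S A)
    {d : ℕ} (φ : S → EuclideanSpace ℝ (Fin d))
    (hφ : LinearIndependent ℝ (featureMatrix φ).col)
    (hcov : Coverage π μ)
    (hirr : (transMatrix M μ).IsIrreducible)
    (haper : IsAperiodic (transMatrix M μ)) :
    ∃ dμ f : S → ℝ,
      -- `dμ` is the unique stationary distribution under the behavior policy
      IsStationaryDist (transMatrix M μ) dμ ∧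
      (∀ d', IsStationaryDist (transMatrix M μ) d' → d' = dμ) ∧
      -- `f i = dμ i * lim E[F_t | s_t = i]`, whatever the initial distribution
      (∀ (X : Trajectory.{u, v, w} M μ) (i : S),
        Tendsto (fun t => dμ i * X.condTrace π t i) atTop (𝓝 (f i))) ∧
      -- the fixed point and the constants are well defined
      IsUnit (keyMatrix M π φ f).det ∧
      (0 < d → 0 < mu0 M π φ f) ∧
      ‖thetaStar M π φ f‖ ≤ Btheta M π φ f ∧
      (∃ CM χ : ℝ, IsGeometricRate (transMatrix M μ) dμ CM χ ∧ χ ≠ M.γ) ∧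
      -- convergence rates and sample complexities
      ∀ CM χ : ℝ, IsGeometricRate (transMatrix M μ) dμ CM χ → χ ≠ M.γ →
        (M.γ ^ 2 * rhoMax π μ ≤ 1 →
          (∃ (C : ℝ) (k : ℕ), ∀ T : ℕ, 2 ≤ T → ∀ X : Trajectory.{u, v, w} M μ,
            X.Accurate π φ f (periodLow M π φ f CM χ T) T (C * Real.log T ^ k / T)) ∧
          (∃ (C : ℝ) (k : ℕ), ∀ ε : ℝ, 0 < ε → ε ≤ 1 / 2 → ∃ T : ℕ, 1 ≤ T ∧
            (∀ X : Trajectory.{u, v, w} M μ, X.Accurate π φ f (periodLow M π φ f CM χ T) T ε) ∧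
            (T * (periodLow M π φ f CM χ T + 1) : ℝ) ≤ C * (1 / ε) * Real.log (1 / ε) ^ k)) ∧
        (1 < M.γ ^ 2 * rhoMax π μ →
          0 < rateExp M π μ χ ∧ rateExp M π μ χ < 1 ∧
          (∃ C : ℝ, ∀ T : ℕ, 1 ≤ T → ∀ X : Trajectory.{u, v, w} M μ,
            X.Accurate π φ f (periodHigh M π μ φ f CM χ T) T
              (C / (T : ℝ) ^ rateExp M π μ χ)) ∧
          (∃ (C : ℝ) (k : ℕ), ∀ ε : ℝ, 0 < ε → ε ≤ 1 / 2 → ∃ T : ℕ, 1 ≤ T ∧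
            (∀ X : Trajectory.{u, v, w} M μ, X.Accurate π φ f (periodHigh M π μ φ f CM χ T) T ε) ∧
            (T * (periodHigh M π μ φ f CM χ T + 1) : ℝ) ≤
              C * (1 / ε) ^ (1 / rateExp M π μ χ) * Real.log (1 / ε) ^ k)) := by
  have hprim := isPrimitive_of_isIrreducible_of_isAperiodic hirr haper
  obtain ⟨dμ, hstat, huniq, hd, C₀, χ₀, hG₀⟩ :=
    exists_isStationaryDist (transMatrix_mem_rowStochastic M μ) hprim
  obtain ⟨f, hf⟩ := exists_isEmphasis M.γ_pos.le M.γ_lt_one (transMatrix_mem_rowStochastic M π) hd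
    hstat.sum_eq_one
  -- A rate may always be enlarged below one, so the midpoint between `max χ₀ γ` and 1 avoids `γ`.
  have hrate : ∃ CM χ : ℝ, IsGeometricRate (transMatrix M μ) dμ CM χ ∧ χ ≠ M.γ := by
    have h1 : max χ₀ M.γ < 1 := max_lt hG₀.χ_lt_one M.γ_lt_one
    have h2 := le_max_left χ₀ M.γ
    have h3 := le_max_right χ₀ M.γ
    exact ⟨C₀, (max χ₀ M.γ + 1) / 2, hG₀.mono (by linarith) (by linarith), by
      intro h
      linarith⟩
  obtain ⟨C₁, χ₁, hG₁, hne₁⟩ := hrate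
  refine ⟨dμ, f, hstat, huniq, fun X i => X.tendsto_condTrace hcov hf hG₁ hne₁ (hd i),
    isUnit_det_keyMatrix hφ hd hf, fun h => (mu0_spec hφ hd hf h).1, norm_thetaStar_le hφ hd hf,
    ⟨C₁, χ₁, hG₁, hne₁⟩, fun CM χ hG hne => ⟨fun hq => ?_, fun hq => ?_⟩⟩
  · obtain ⟨C, hC, hacc⟩ := exists_accurate_periodLow.{u, v, w} hφ hcov hd hf hG hne hq
    obtain ⟨C', hC'⟩ := exists_iterations_of_log_div C _ hC
      (log_one_div_xi_pos (M := M) hG.χ_lt_one) (basePeriod M π φ f CM χ)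
    refine ⟨⟨C, 1, fun T hT X => by simpa using hacc T hT X⟩, C', 2, fun ε hε hε2 => ?_⟩
    obtain ⟨T, hT, hTε, hsamp⟩ := hC' ε hε hε2
    exact ⟨T, by omega, fun X => (hacc T hT X).mono hTε, hsamp⟩
  · obtain ⟨ha0, ha1⟩ := rateExp_mem_Ioo (M := M) (π := π) (μ := μ) hG.χ_lt_one hq
    obtain ⟨C, hC, hacc⟩ := exists_accurate_periodHigh.{u, v, w} hφ hcov hd hf hG hne hq
    obtain ⟨C', hC'⟩ := exists_iterations_of_rpow C _ _ hC
      (add_pos (Real.log_pos hq) (log_one_div_xi_pos (M := M) hG.χ_lt_one)) ha0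
      (basePeriod M π φ f CM χ)
    refine ⟨ha0, ha1, ⟨C, hacc⟩, C', 1, fun ε hε hε2 => ?_⟩
    obtain ⟨T, hT, hTε, hsamp⟩ := hC' ε hε hε2
    exact ⟨T, hT, fun X => (hacc T hT X).mono hTε, hsamp⟩
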